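/- Let $\mathcal A$ be an alphabet with $d\ge 2$ letters. A \emph{combinatorial datum} is a pair $\pi=(\pi_t,\pi_b)$ of bijections $\mathcal A\to\{1,\dots,d\}$ (top and bottom row); it is irreducible if for no $1\le k<d$ the first $k$ letters of the two rows form the same set. Let $\alpha,\beta$ be the last letters of the top and bottom rows of $\pi$. The top operation moves $\beta$, in the bottom row, to the place immediately to the right of $\alpha$ (winner $\alpha$, loser $\beta$); the bottom operation moves $\alpha$, in the top row, to the place immediately to the right of $\beta$ (winner $\beta$, loser $\alpha$). A Rauzy class $\mathfrak R$ is a minimal non-empty set of irreducible data invariant under both operations; its Rauzy diagram has vertex set $\mathfrak R$ and, from each vertex, one top and one bottom arrow to the images under the two operations. For an arrow $\gamma$ with winner $w$ and loser $l$ let $B_\gamma e_w=e_w+e_l$ and $B_\gamma e_\xi=e_\xi$ for $\xi\ne w$; for paths, $B_{\gamma_1\gamma_2}=B_{\gamma_2}B_{\gamma_1}$. Write $B^*$ for the transpose of $B$. For $\lambda\in\mathbb R_+^{\mathcal A}$ (where $\mathbb R_+=(0,\infty)$) with $\lambda_\alpha\neq\lambda_\beta$, put $Q(\lambda,\pi)=((B_\gamma^*)^{-1}\lambda,\pi')$,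 where $\gamma:\pi\to\pi'$ is the top arrow if $\lambda_\alpha>\lambda_\beta$ and the bottom arrow if $\lambda_\beta>\lambda_\alpha$. For a path $\gamma$ starting at $\pi$, $\Delta_\gamma$ is the set of $(\lambda,\pi)$ whose successive steps under $Q$ follow $\gamma$. Let $\Theta_\pi$ be the set of $\tau\in\mathbb R^{\mathcal A}$ with $\sum_{\pi_t(\xi)\le k}\tau_\xi>0$ and $\sum_{\pi_b(\xi)\le k}\tau_\xi<0$ for $1\le k\le d-1$, and define $\Theta_\gamma$ by $B_\gamma^*\Theta_\gamma=\Theta_\pi$. On $\widehat\Delta_{\mathfrak R}=\{(\lambda,\pi,\tau):\lambda\in\mathbb R_+^{\mathcal A},\ \pi\in\mathfrak R,\ \tau\in\Theta_\pi\}$ let $\widehat Q(\lambda,\pi,\tau)=(Q(\lambda,\pi),(B_\gamma^*)^{-1}\tau)$, defined when $\lambda_\alpha\ne\lambda_\beta$, with $\gamma$ the arrow above. Put $\|\lambda\|=\sum_\xi\lambda_\xi$ and $\phi(\lambda,\pi,\tau)=\|\lambda\|$. Let $A(\lambda,\pi,\tau)=-\langle\lambda,\Omega(\pi)\tau\rangle$,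 where $\langle\Omega(\pi)e_x,e_y\rangle$ is $1$ if $\pi_t(x)>\pi_t(y)$ and $\pi_b(x)<\pi_b(y)$, is $-1$ if $\pi_t(x)<\pi_t(y)$ and $\pi_b(x)>\pi_b(y)$, and is $0$ otherwise. Let $\mho_{\mathfrak R}$ be the set of $x\in\widehat\Delta_{\mathfrak R}$ such that either $\widehat Q(x)$ is defined and $\phi(\widehat Q(x))<1\le\phi(x)$, or $\widehat Q(x)$ is not defined and $\phi(x)\ge 1$, or $\widehat Q^{-1}(x)$ is not defined and $\phi(x)<1$. The Veech flow at time $t$ maps $x=(\lambda,\pi,\tau)\in\mho_{\mathfrak R}$ to the point of $\mho_{\mathfrak R}$ in the $\widehat Q$-orbit of $(e^t\lambda,\pi,e^{-t}\tau)$. Let $\widehat\Upsilon^{(1)}_{\mathfrak R}=\{x\in\mho_{\mathfrak R}:A(x)=1,\ \phi(x)=1\}$. Let $\gamma_*$ be a neat path in the Rauzy diagram: it starts and ends at the same $\pi\in\mathfrak R$; it is strongly positive, that is, all entries of $B_{\gamma_*}$ are positive and $(B_{\gamma_*}^*)^{-1}(\overline{\Theta}_\pi\setminus\{0\})\subset\Theta_\pi$;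 and whenever $\gamma_*=\gamma_s\gamma=\gamma\gamma_e$, either $\gamma=\gamma_*$ or $\gamma$ is trivial. Let $\widehat\Xi=\widehat\Upsilon^{(1)}_{\mathfrak R}\cap(\Delta_{\gamma_*}\times\Theta_{\gamma_*})$, and let $\Xi=\{(\lambda,\pi)\in\Delta_{\gamma_*}:\|\lambda\|=1\}$ with its $(d-1)$-dimensional Lebesgue measure $\mathrm{Leb}$. Then for $\mathrm{Leb}$-almost every $(\lambda,\pi)\in\Xi$ all points $(\lambda,\pi,\tau)\in\widehat\Xi$ return to $\widehat\Xi$ under the Veech flow, with the same first return time $r_\Xi(\lambda,\pi)>0$; and the function $r_\Xi$ has exponential tails: there is $\sigma_0>0$ such that $$\int_\Xi e^{\sigma_0 r_\Xi}\,d\mathrm{Leb}<\infty .$$ -/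

import Mathlib

noncomputable section

namespace Veech

open MeasureTheory Matrix

variable {A : Type*} [Fintype A] [DecidableEq A] [Nontrivial A]

/-! ### Combinatorial data and Rauzy classes -/

/-- A pair of bijections from the alphabet to the positions `0, …, d - 1`, where `d` is the number
of letters: `top ξ` and `bot ξ` are the positions of `ξ` in the top and in the bottom row. -/
structure CombData (A : Type*) [Fintype A] where
  top : A ≃ Fin (Fintype.card A)
  bot : A ≃ Fin (Fintype.card A)

/-- No `k` with `1 ≤ k < d` is such that the sets of the first `k` letters of the two rows
coincide. -/
def CombData.Irreducible (π : CombData A) : Prop :=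
  ∀ k : ℕ, 1 ≤ k → k < Fintype.card A →
    {ξ : A | (π.top ξ : ℕ) < k} ≠ {ξ : A | (π.bot ξ : ℕ) < k}

/-- The last letter of the top row. -/
def CombData.topLast (π : CombData A) : A :=
  π.top.symm ⟨Fintype.card A - 1, Nat.sub_lt Fintype.card_pos one_pos⟩

/-- The last letter of the bottom row. -/
def CombData.botLast (π : CombData A) : A :=
  π.bot.symm ⟨Fintype.card A - 1, Nat.sub_lt Fintype.card_pos one_pos⟩

/-- New position of the letter at position `j` when the last letter of a row is moved to the place
immediately to the right of position `k`. -/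
def moveLast {n : ℕ} (k j : Fin n) : Fin n :=
  if h : j ≤ k then j
  else if h' : (j : ℕ) + 1 = n then ⟨(k : ℕ) + 1, by have := j.2; omega⟩
  else ⟨(j : ℕ) + 1, by have := j.2; omega⟩

theorem moveLast_injective {n : ℕ} (k : Fin n) : Function.Injective (moveLast k) := by
  intro i j hij
  have hi := i.2
  have hj := j.2
  unfold moveLast at hij
  split_ifs at hij <;> simp only [Fin.ext_iff, Fin.le_def] at * <;> omega

/-- `moveLast k` as a permutation of the positions. -/
def moveLastPerm {n : ℕ} (k : Fin n) : Equiv.Perm (Fin n) :=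
  Equiv.ofBijective (moveLast k) (Finite.injective_iff_bijective.mp (moveLast_injective k))

/-- The two types of arrows of a Rauzy diagram. -/
inductive ArrowType where
  | top
  | bottom

/-- The winner of the arrow of the given type that starts at `π`. -/
def winner : ArrowType → CombData A → A
  | .top, π => π.topLast
  | .bottom, π => π.botLast

/-- The loser of the arrow of the given type that starts at `π`. -/
def loser : ArrowType → CombData A → A
  | .top, π => π.botLast
  | .bottom, π => π.topLast

/-- The top operation moves, in the bottom row, the last letter `β` to the place immediately to
the right of `α`, the last letter of the top row; the bottom operation is the symmetric one. -/
def rauzyOp : ArrowType → CombData A → CombData A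
  | .top, π => ⟨π.top, π.bot.trans (moveLastPerm (π.bot π.topLast))⟩
  | .bottom, π => ⟨π.top.trans (moveLastPerm (π.top π.botLast)), π.bot⟩

/-- A Rauzy class: a minimal non-empty set of irreducible combinatorial data that is invariant
under the top and bottom operations. -/
def IsRauzyClass (R : Set (CombData A)) : Prop :=
  Minimal (fun S : Set (CombData A) =>
    S.Nonempty ∧ (∀ π ∈ S, π.Irreducible) ∧ ∀ π ∈ S, ∀ ε, rauzyOp ε π ∈ S) R

/-- The vertices of the Rauzy diagram of `R`. -/
structure Vertex (R : Set (CombData A)) where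
  val : CombData A
  mem : val ∈ R

/-- The Rauzy diagram: one arrow of each type from `π` to its image under that operation. Paths in
the diagram are Mathlib's `Quiver.Path`. -/
instance (R : Set (CombData A)) : Quiver (Vertex R) where
  Hom π π' := {ε : ArrowType // rauzyOp ε π.val = π'.val}

/-- The matrix `B` of an arrow with winner `α` and loser `β`: `B e_α = e_α + e_β`, and
`B e_ξ = e_ξ` for `ξ ≠ α`. -/
def arrowMatrix (ε : ArrowType) (π : CombData A) : Matrix A A ℝ :=
  1 + Matrix.single (loser ε π) (winner ε π) 1

/-- The matrix `B_γ` of a path, with `B_{γ₁ γ₂} = B_{γ₂} B_{γ₁}`. -/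
def pathMatrix {R : Set (CombData A)} :
    {π π' : Vertex R} → Quiver.Path π π' → Matrix A A ℝ
  | _, _, .nil => 1
  | _, _, .cons (b := ρ) γ a => arrowMatrix a.1 ρ.val * pathMatrix γ

/-! ### Rauzy induction -/

/-- The type of the Rauzy induction step at `(lam, π)`: top when `lam_α > lam_β`, bottom when
`lam_β > lam_α`, for `α`, `β` the last letters of the top and bottom rows. (It is only used
when `lam_α ≠ lam_β`.) -/
def inductionType (lam : A → ℝ) (π : CombData A) : ArrowType :=
  open Classical in if lam π.botLast < lam π.topLast then .top else .bottom

/-- The new lengths: the winner gets `|lam_α - lam_β|`, the other letters keep their length. -/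
def inductionLengths (lam : A → ℝ) (π : CombData A) : A → ℝ :=
  Function.update lam (winner (inductionType lam π) π) |lam π.topLast - lam π.botLast|

/-- The Rauzy induction map `Q`. It is meaningful when the last letters of the two rows have
different lengths. -/
def rauzyQ (x : (A → ℝ) × CombData A) : (A → ℝ) × CombData A :=
  (inductionLengths x.1 x.2, rauzyOp (inductionType x.1 x.2) x.2)

/-- `Δ_π`: positive length vectors over the vertex `π`. -/
def lengthCone (π : CombData A) : Set ((A → ℝ) × CombData A) :=
  {x | (∀ ξ, 0 < x.1 ξ) ∧ x.2 = π}

/-- `Δ_a` for an arrow `a` starting at `π`: the data over `π` to which Rauzy induction of that type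
applies. -/
def arrowCone (ε : ArrowType) (π : CombData A) : Set ((A → ℝ) × CombData A) :=
  {x ∈ lengthCone π | x.1 (loser ε π) < x.1 (winner ε π)}

/-- `Δ_γ`: the data whose successive Rauzy induction steps follow the path `γ`. -/
def pathCone {R : Set (CombData A)} :
    {π π' : Vertex R} → Quiver.Path π π' → Set ((A → ℝ) × CombData A)
  | π, _, .nil => lengthCone π.val
  | _, _, .cons (b := ρ) γ a => {x ∈ pathCone γ | rauzyQ^[γ.length] x ∈ arrowCone a.1 ρ.val}

/-! ### Zippered rectangles -/

/-- The cone `Θ_π` of suspension data. -/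
def suspCone (π : CombData A) : Set (A → ℝ) :=
  {τ | ∀ k : ℕ, 1 ≤ k → k ≤ Fintype.card A - 1 →
    0 < ∑ ξ with (π.top ξ : ℕ) < k, τ ξ ∧ ∑ ξ with (π.bot ξ : ℕ) < k, τ ξ < 0}

/-- `Θ_γ`, determined by `B_γ^* Θ_γ = Θ_π` for `π` the start of `γ` (`B_γ` is invertible). -/
def pathSuspCone {R : Set (CombData A)} {π π' : Vertex R} (γ : Quiver.Path π π') :
    Set (A → ℝ) :=
  {τ | (pathMatrix γ)ᵀ *ᵥ τ ∈ suspCone π.val}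

/-- The matrix of `Ω(π)`: the entry in row `y` and column `x` is `⟨Ω(π) e_x, e_y⟩`. -/
def omega (π : CombData A) : Matrix A A ℝ :=
  Matrix.of fun y x =>
    if π.top y < π.top x ∧ π.bot x < π.bot y then 1
    else if π.top x < π.top y ∧ π.bot y < π.bot x then -1
    else 0

/-- A triple `(lam, π, τ)`. -/
@[ext] structure Zippered (A : Type*) [Fintype A] where
  lam : A → ℝ
  comb : CombData A
  tau : A → ℝ

/-- The space of zippered rectangles over `R`. -/
def zipperedSpace (R : Set (CombData A)) : Set (Zippered A) :=
  {x | x.comb ∈ R ∧ (∀ ξ, 0 < x.lam ξ) ∧ x.tau ∈ suspCone x.comb}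

/-- The norm of the length vector. -/
def phi (x : Zippered A) : ℝ := ∑ ξ, x.lam ξ

/-- The area `-⟨lam, Ω(π) τ⟩`. -/
def area (x : Zippered A) : ℝ := -(x.lam ⬝ᵥ (omega x.comb *ᵥ x.tau))

/-- Domain of the extended induction map `Q̂`. -/
def qHatDomain (R : Set (CombData A)) : Set (Zippered A) :=
  {x ∈ zipperedSpace R | x.lam x.comb.topLast ≠ x.lam x.comb.botLast}

/-- The extended induction map `Q̂ (lam, π, τ) = (Q (lam, π), (B^*)⁻¹ τ)`. -/
def qHat (x : Zippered A) : Zippered A where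
  lam := (rauzyQ (x.lam, x.comb)).1
  comb := (rauzyQ (x.lam, x.comb)).2
  tau := ((arrowMatrix (inductionType x.lam x.comb) x.comb)ᵀ)⁻¹ *ᵥ x.tau

/-- `y = Q̂ x`, with `x` in the domain of `Q̂`. -/
def QHatStep (R : Set (CombData A)) (x y : Zippered A) : Prop :=
  x ∈ qHatDomain R ∧ qHat x = y

/-- `y = Q̂ⁿ x` for some integer `n`. -/
def SameOrbit (R : Set (CombData A)) (x y : Zippered A) : Prop :=
  Relation.ReflTransGen (QHatStep R) x y ∨ Relation.ReflTransGen (QHatStep R) y x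

/-- The fundamental domain `℧_R` of `Q̂`. -/
def fundDomain (R : Set (CombData A)) : Set (Zippered A) :=
  {x ∈ zipperedSpace R |
    (x ∈ qHatDomain R ∧ phi (qHat x) < 1 ∧ 1 ≤ phi x) ∨
    (x ∉ qHatDomain R ∧ 1 ≤ phi x) ∨
    ((¬ ∃ z, QHatStep R z x) ∧ phi x < 1)}

/-- The flow `(lam, π, τ) ↦ (e^t lam, π, e^{-t} τ)`. -/
def scaleFlow (t : ℝ) (x : Zippered A) : Zippered A where
  lam := Real.exp t • x.lam
  comb := x.comb
  tau := Real.exp (-t) • x.tau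

/-- The Veech flow takes `x` to `y` in time `t`: `y` is the point of the fundamental domain
in the `Q̂`-orbit of the image of `x` under the scaling flow. -/
def VeechFlowTo (R : Set (CombData A)) (t : ℝ) (x y : Zippered A) : Prop :=
  y ∈ fundDomain R ∧ SameOrbit R (scaleFlow t x) y

/-- The transversal `Υ̂⁽¹⁾_R`: points of the fundamental domain with area `1` and length `1`. -/
def transversal (R : Set (CombData A)) : Set (Zippered A) :=
  {x ∈ fundDomain R | area x = 1 ∧ phi x = 1}

/-! ### Neat loops and the precompact section -/

/-- A path is strongly positive if all entries of `B_γ` are positive and `(B_γ^*)⁻¹` maps the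
closure of `Θ` at the start, except `0`, into `Θ` at the end. -/
def StronglyPositive {R : Set (CombData A)} {π π' : Vertex R} (γ : Quiver.Path π π') : Prop :=
  (∀ ξ η, 0 < pathMatrix γ ξ η) ∧
    ∀ τ ∈ closure (suspCone π.val) \ {0}, ((pathMatrix γ)ᵀ)⁻¹ *ᵥ τ ∈ suspCone π'.val

/-- A neat loop: strongly positive, and no proper non-trivial path is both an initial and a final
segment of it. (Such a segment of a loop at `π` is itself a loop at `π`.) -/
def Neat {R : Set (CombData A)} {π : Vertex R} (γ : Quiver.Path π π) : Prop :=
  StronglyPositive γ ∧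
    ∀ δ γs γe : Quiver.Path π π, γ = γs.comp δ → γ = δ.comp γe → δ = γ ∨ δ = .nil

/-- The section `Ξ̂ = Υ̂⁽¹⁾_R ∩ (Δ_γ × Θ_γ)`. -/
def sectionHat {R : Set (CombData A)} {π : Vertex R} (γ : Quiver.Path π π) :
    Set (Zippered A) :=
  {x ∈ transversal R | (x.lam, x.comb) ∈ pathCone γ ∧ x.tau ∈ pathSuspCone γ}

/-- The base `Ξ` of the section: the length vectors of norm `1` in `Δ_γ`. -/
def baseSection {R : Set (CombData A)} {π : Vertex R} (γ : Quiver.Path π π) :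
    Set (A → ℝ) :=
  {lam | (lam, π.val) ∈ pathCone γ ∧ ∑ ξ, lam ξ = 1}

/-- The positive times at which the Veech flow takes `x` into `Ξ̂`. -/
def returnTimes {R : Set (CombData A)} {π : Vertex R} (γ : Quiver.Path π π)
    (x : Zippered A) : Set ℝ :=
  {t | 0 < t ∧ ∃ y ∈ sectionHat γ, VeechFlowTo R t x y}

/-- The roof function `r_Ξ`: the first time at which a point of `Ξ̂` over `lam` returns to `Ξ̂`.
(The return times do not depend on the point chosen over `lam`.) -/
def roof {R : Set (CombData A)} {π : Vertex R} (γ : Quiver.Path π π) (lam : A → ℝ) : ℝ :=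
  sInf {t | ∃ τ : A → ℝ, (⟨lam, π.val, τ⟩ : Zippered A) ∈ sectionHat γ ∧
    t ∈ returnTimes γ ⟨lam, π.val, τ⟩}

/-! ### Lebesgue measure on the section, and exponential tails -/

/-- Vectors with vanishing coordinate sum. -/
def sumZero (A : Type*) [Fintype A] : Submodule ℝ (EuclideanSpace ℝ A) where
  carrier := {v | ∑ ξ, v ξ = 0}
  zero_mem' := by simp
  add_mem' := by
    intro v w hv hw
    simp only [Set.mem_ofPred_eq, PiLp.add_apply, Finset.sum_add_distrib] at *
    rw [hv, hw, add_zero]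
  smul_mem' := by
    intro c v hv
    simp only [Set.mem_ofPred_eq, PiLp.smul_apply, smul_eq_mul, ← Finset.mul_sum] at *
    rw [hv, mul_zero]

/-- The Euclidean Lebesgue measure on the affine hyperplane `∑ lam_ξ = 1`, obtained by translating
the volume of the parallel linear hyperplane by the barycentre `(1/d, …, 1/d)`. -/
def hyperplaneLebesgue (A : Type*) [Fintype A] : Measure (A → ℝ) :=
  (volume : Measure (sumZero A)).map
    fun (v : sumZero A) (ξ : A) => (v : EuclideanSpace ℝ A) ξ + (Fintype.card A : ℝ)⁻¹

/-- `r` has exponential tails with respect to `μ`: `∫ exp (σ₀ r) dμ < ∞` for some `σ₀ > 0`. -/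
def HasExponentialTails {X : Type*} [MeasurableSpace X] (μ : Measure X) (r : X → ℝ) : Prop :=
  ∃ σ₀ : ℝ, 0 < σ₀ ∧ Integrable (fun x => Real.exp (σ₀ * r x)) μ

end Veech

end

noncomputable section

namespace Veech

open MeasureTheory Matrix

open scoped Pointwise

/-! ### Moving the last letter of a row, and maximal words in a subset of the letters -/

section Rows

variable {A : Type*} {n : ℕ}

/-! Rauzy induction of a random length vector is studied through a dual random walk. Give the
letters positive weights `q`, and let an arrow replace `q` by `B q`. The simplex `{λ > 0 : ⟨q, λ⟩ <
1}` has volume proportional to `∏ q⁻¹`, and inverse induction, which preserves volume, puts the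
simplices of the two successors into disjoint parts of it. Thus an arrow has conditional probability
equal to the weight of the loser divided by the sum of the weights of loser and winner. `Reach`
records lower bounds for hitting probabilities by finite trees, and `Reach.volume_le` turns them
into volumes.

The core is `Reach.word_of_le`: if all weights are at most `u`, a prescribed word (here the loop `γ`
twice) occurs with probability at least `ρ` while the weights stay below `K u`, however small some
of them were. Scale to `u = 1` and keep a set `S` of letters of weight at least `1`. The potential
`∑_{ξ ∈ S} q_ξ / (q_ξ + L)` does not increase on average until a letter outside `S` gets weight `1`
or both last letters lie in `S` (`Reach.phase_aux`). In the second case a path of bounded length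
with all losers in `S` lowers the number of maximal words in letters of `S`, counted after a gluing
that keeps this number from growing when the winner is outside `S` (`exists_gluedCount_lt`,
`gluedCount_rauzyOp_le`). So after boundedly many rounds a new letter joins `S`
(`Reach.new_letter`), finally all weights are comparable (`Reach.balanced_of_subset`), and then
every fixed path has probability bounded below. Positivity of `B_γ` enters because it forces every
letter to win somewhere. Repeated trials make the failure probability geometric in the logarithm of
the growth (`Reach.word_iterate`).

Returns are occurrences of words: by neatness, and because `τ` determines the past arrows as `λ`
determines the future ones, a return happens exactly after `u γ` when `λ` follows `u γ γ` with `u` a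
loop, and the return time is minus the logarithm of the length reached (`mem_returnTimes`). The
pairing of weights and lengths is invariant, so weights at most `K ^ k` at the occurrence bound the
return time by `k log K`. The exceptional sets are cones, so their volumes control Lebesgue measure
on the section. -/

theorem moveLast_val (k j : Fin n) :
    (moveLast k j : ℕ) = if (j : ℕ) ≤ k then (j : ℕ) else if (j : ℕ) + 1 = n then k + 1 else j + 1 := by
  unfold moveLast
  simp only [Fin.le_def]
  split_ifs <;> rfl

/-- Moving the last letter of a row to the right of the letter `b`. -/
def moveRow (r : A ≃ Fin n) (b : A) : A ≃ Fin n := r.trans (moveLastPerm (r b))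

theorem moveRow_val (r : A ≃ Fin n) (b x : A) :
    (r x : ℕ) ≤ r b ∧ (moveRow r b x : ℕ) = r x ∨
      r b < (r x : ℕ) ∧ (r x : ℕ) + 1 = n ∧ (moveRow r b x : ℕ) = r b + 1 ∨
      r b < (r x : ℕ) ∧ (r x : ℕ) + 1 ≠ n ∧ (moveRow r b x : ℕ) = r x + 1 := by
  have h : (moveRow r b x : ℕ) = _ := moveLast_val (r b) (r x)
  split_ifs at h <;> omega

theorem row_ext (r : A ≃ Fin n) {x y : A} (h : (r x : ℕ) = r y) : x = y :=
  r.injective (Fin.ext h)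

open Classical in
/-- The letters of `S` that start a maximal word in letters of `S`. -/
def runStarts (r : A ≃ Fin n) (S : Finset A) : Finset A :=
  {x ∈ S | ∀ u, (r u : ℕ) + 1 = r x → u ∉ S}

open Classical in
/-- The letters that start a maximal word in letters of `S`, when a final word in letters of `S`
is glued to the word that follows the letter `b`; here `a` is the last letter. -/
def gluedStarts (r : A ≃ Fin n) (S : Finset A) (a b : A) : Finset A :=
  {x ∈ S | ∀ u, (r u : ℕ) + 1 = r x → u ∉ S ∧ (u = b → a ∉ S)}

theorem gluedStarts_subset (r : A ≃ Fin n) (S : Finset A) (a b : A) :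
    gluedStarts r S a b ⊆ runStarts r S := by
  intro x hx
  simp only [gluedStarts, runStarts, Finset.mem_filter] at *
  exact ⟨hx.1, fun u hu => (hx.2 u hu).1⟩

theorem gluedStarts_eq (r : A ≃ Fin n) (S : Finset A) {a b : A} (hb : b ∈ S) :
    gluedStarts r S a b = runStarts r S := by
  refine (gluedStarts_subset r S a b).antisymm fun x hx => ?_
  simp only [gluedStarts, runStarts, Finset.mem_filter] at *
  refine ⟨hx.1, fun u hu => ⟨hx.2 u hu, ?_⟩⟩
  rintro rfl
  exact absurd hb (hx.2 _ hu)

theorem gluedStarts_eq_of_last_notMem (r : A ≃ Fin n) (S : Finset A) {a b : A} (ha : a ∉ S) :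
    gluedStarts r S a b = runStarts r S := by
  refine (gluedStarts_subset r S a b).antisymm fun x hx => ?_
  simp only [gluedStarts, runStarts, Finset.mem_filter] at *
  exact ⟨hx.1, fun u hu => ⟨hx.2 u hu, fun _ => ha⟩⟩

/-- The gluing anticipates the move. If `a` is in `S`, its word was already counted as attached to
the word after `b`; after the move `a` stands there, and the rest of its old word, if any, is again
final and is glued to `a`. -/
theorem gluedStarts_moveRow_subset (r : A ≃ Fin n) (S : Finset A) {a a' b : A}
    (ha : (r a : ℕ) + 1 = n) (hab : b ≠ a) (ha' : (moveRow r b a' : ℕ) + 1 = n) (hb : b ∉ S) :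
    gluedStarts (moveRow r b) S a' b ⊆ gluedStarts r S a b := by
  intro x hx
  simp only [gluedStarts, Finset.mem_filter] at *
  refine ⟨hx.1, fun u hu => ?_⟩
  have hba : (r b : ℕ) ≠ r a := fun h => hab (row_ext r h)
  have hbn := (r b).2
  have hxn := (r x).2
  have hun := (r u).2
  have han := (r a').2
  have va := moveRow_val r b a
  have va' := moveRow_val r b a'
  have vb := moveRow_val r b b
  have vx := moveRow_val r b x
  have vu := moveRow_val r b u
  by_cases hxa : x = a
  · subst hxa
    by_cases hub : u = b
    · subst hub
      have h1 := (hx.2 u (by omega)).2 rfl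
      have : a' = x := row_ext (moveRow r u) (by omega)
      subst this
      exact absurd hx.1 h1
    · have hub' : (r u : ℕ) ≠ r b := fun h => hub (row_ext r h)
      have h1 := (hx.2 b (by omega)).2 rfl
      have : a' = u := row_ext (moveRow r b) (by omega)
      subst this
      exact ⟨h1, fun h => absurd h hub⟩
  · have hxa' : (r x : ℕ) ≠ r a := fun h => hxa (row_ext r h)
    by_cases hub : u = b
    · subst hub
      have h1 := (hx.2 a (by omega)).1
      exact ⟨hb, fun _ => h1⟩
    · have hub' : (r u : ℕ) ≠ r b := fun h => hub (row_ext r h)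
      have h1 := (hx.2 u (by omega)).1
      exact ⟨h1, fun h => absurd h hub⟩

/-- The letter `a` is inserted after a letter of `S`, so it starts no word; the letter that used to
follow `b` now follows `a`, which is in `S` as well. -/
theorem runStarts_moveRow_subset [DecidableEq A] (r : A ≃ Fin n) (S : Finset A) {a b : A}
    (ha : (r a : ℕ) + 1 = n) (hab : b ≠ a) (hb : b ∈ S) (haS : a ∈ S) :
    runStarts (moveRow r b) S ⊆ (runStarts r S).erase a := by
  intro x hx
  simp only [runStarts, Finset.mem_filter, Finset.mem_erase] at *
  have hba : (r b : ℕ) ≠ r a := fun h => hab (row_ext r h)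
  have hbn := (r b).2
  have va := moveRow_val r b a
  have vb := moveRow_val r b b
  have vx := moveRow_val r b x
  have hxa : x ≠ a := by
    rintro rfl
    exact hx.2 b (by omega) hb
  refine ⟨hxa, hx.1, fun u hu => ?_⟩
  have hxa' : (r x : ℕ) ≠ r a := fun h => hxa (row_ext r h)
  have hxn := (r x).2
  have hun := (r u).2
  have vu := moveRow_val r b u
  by_cases hub : u = b
  · subst hub
    exact absurd haS (hx.2 a (by omega))
  · have hub' : (r u : ℕ) ≠ r b := fun h => hub (row_ext r h)
    exact hx.2 u (by omega)

/-- The new last letter `a'` is the one that preceded `a`, so if it is outside `S` the word of `a`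
was the single letter `a`. -/
theorem mem_runStarts_of_moveRow (r : A ≃ Fin n) (S : Finset A) {a a' b : A}
    (ha : (r a : ℕ) + 1 = n) (ha' : (moveRow r b a' : ℕ) + 1 = n)
    (haS : a ∈ S) (ha'S : a' ∉ S) : a ∈ runStarts r S := by
  simp only [runStarts, Finset.mem_filter]
  refine ⟨haS, fun u hu => ?_⟩
  have hbn := (r b).2
  have hun := (r u).2
  have han := (r a').2
  have va := moveRow_val r b a
  have va' := moveRow_val r b a'
  have vu := moveRow_val r b u
  have haa' : (r a : ℕ) ≠ r a' := fun h => ha'S (row_ext r h ▸ haS)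
  have : a' = u := row_ext r (by omega)
  rwa [← this]

end Rows

/-! ### Combinatorial data: symmetry, injectivity of the operations, word counts -/

section Comb

variable {A : Type*} [Fintype A]

@[ext] theorem CombData.ext' {π ρ : CombData A} (h : π.top = ρ.top) (h' : π.bot = ρ.bot) :
    π = ρ := by
  cases π; cases ρ; simp_all

instance : Finite (CombData A) :=
  Finite.of_injective (fun π : CombData A => (π.top, π.bot)) fun π ρ h => by
    simp only [Prod.mk.injEq] at h
    exact CombData.ext' h.1 h.2

/-- Exchange of the two rows. -/
def CombData.swap (π : CombData A) : CombData A := ⟨π.bot, π.top⟩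

/-- Exchange of the two types of arrows. -/
def ArrowType.flip : ArrowType → ArrowType
  | .top => .bottom
  | .bottom => .top

instance : DecidableEq ArrowType := fun a b => by
  cases a <;> cases b <;> first | exact isTrue rfl | exact isFalse (by intro h; cases h)

instance : Fintype ArrowType := ⟨{.top, .bottom}, fun x => by cases x <;> simp⟩

variable [Nontrivial A]

@[simp] theorem winner_flip (ε : ArrowType) (π : CombData A) :
    winner ε.flip π = loser ε π := by cases ε <;> rfl

@[simp] theorem loser_flip (ε : ArrowType) (π : CombData A) :
    loser ε.flip π = winner ε π := by cases ε <;> rfl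

@[simp] theorem winner_swap (ε : ArrowType) (π : CombData A) :
    winner ε π.swap = winner ε.flip π := by cases ε <;> rfl

@[simp] theorem loser_swap (ε : ArrowType) (π : CombData A) :
    loser ε π.swap = loser ε.flip π := by cases ε <;> rfl

/-- This symmetry reduces every statement about bottom arrows to the one about top arrows. -/
theorem rauzyOp_swap (ε : ArrowType) (π : CombData A) :
    rauzyOp ε π.swap = (rauzyOp ε.flip π).swap := by cases ε <;> rfl

theorem top_topLast (π : CombData A) : (π.top π.topLast : ℕ) + 1 = Fintype.card A := by
  have : 0 < Fintype.card A := Fintype.card_pos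
  simp only [CombData.topLast, Equiv.apply_symm_apply]
  omega

theorem bot_botLast (π : CombData A) : (π.bot π.botLast : ℕ) + 1 = Fintype.card A :=
  top_topLast π.swap

theorem CombData.Irreducible.topLast_ne_botLast {π : CombData A} (h : π.Irreducible) :
    π.topLast ≠ π.botLast := by
  intro he
  have hc : 1 < Fintype.card A := Fintype.one_lt_card
  refine h (Fintype.card A - 1) (by omega) (by omega) ?_
  ext ξ
  simp only [Set.mem_ofPred_eq]
  have h1 := (π.top ξ).2
  have h2 := (π.bot ξ).2
  have h3 := top_topLast π
  have h4 := bot_botLast π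
  rw [← he] at h4
  by_cases hξ : ξ = π.topLast
  · subst hξ; omega
  · have a1 : (π.top ξ : ℕ) ≠ π.top π.topLast := fun h => hξ (row_ext _ h)
    have a2 : (π.bot ξ : ℕ) ≠ π.bot π.topLast := fun h => hξ (row_ext _ h)
    omega

theorem CombData.Irreducible.winner_ne_loser {π : CombData A} (h : π.Irreducible)
    (ε : ArrowType) : winner ε π ≠ loser ε π := by
  cases ε
  exacts [h.topLast_ne_botLast, h.topLast_ne_botLast.symm]

/-- The row of the winner is unchanged, and so is the position of the winner in the other row; this
position determines the permutation to be undone. -/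
theorem rauzyOp_injective (ε : ArrowType) :
    Function.Injective (rauzyOp ε : CombData A → CombData A) := by
  have key : Function.Injective (rauzyOp .top : CombData A → CombData A) := by
    intro π ρ h
    have h1 : (rauzyOp .top π).top = (rauzyOp .top ρ).top := congrArg CombData.top h
    replace h1 : π.top = ρ.top := h1
    have h2 : (rauzyOp .top π).bot = (rauzyOp .top ρ).bot := congrArg CombData.bot h
    replace h2 : moveRow π.bot π.topLast = moveRow ρ.bot ρ.topLast := h2
    have h3 : π.topLast = ρ.topLast := by simp only [CombData.topLast, h1]
    have h4 : π.bot π.topLast = ρ.bot ρ.topLast := by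
      have := congrArg (fun r : A ≃ Fin (Fintype.card A) => (r π.topLast : ℕ)) h2
      rw [← h3] at this ⊢
      have h5 := moveRow_val π.bot π.topLast π.topLast
      have h6 := moveRow_val ρ.bot π.topLast π.topLast
      exact Fin.ext (by omega)
    refine CombData.ext' h1 ?_
    ext x
    have := Equiv.congr_fun h2 x
    simp only [moveRow, Equiv.trans_apply, h4] at this
    rw [(moveLastPerm (ρ.bot ρ.topLast)).injective this]
  cases ε
  · exact key
  · intro π ρ (h : rauzyOp .bottom π = rauzyOp .bottom ρ)
    have h' : rauzyOp .top π.swap = rauzyOp .top ρ.swap := by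
      rw [rauzyOp_swap, rauzyOp_swap]; exact congrArg _ h
    exact congrArg CombData.swap (key h')

/-- The number of maximal words in letters of `S` in the two rows. -/
def runCount (S : Finset A) (π : CombData A) : ℕ :=
  (runStarts π.top S).card + (runStarts π.bot S).card

/-- The number of maximal words in letters of `S` after gluing. -/
def gluedCount (S : Finset A) (π : CombData A) : ℕ :=
  (gluedStarts π.top S π.topLast π.botLast).card + (gluedStarts π.bot S π.botLast π.topLast).card

theorem gluedCount_swap (S : Finset A) (π : CombData A) :
    gluedCount S π.swap = gluedCount S π := Nat.add_comm _ _

theorem runCount_swap (S : Finset A) (π : CombData A) :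
    runCount S π.swap = runCount S π := Nat.add_comm _ _

theorem gluedCount_le_runCount (S : Finset A) (π : CombData A) :
    gluedCount S π ≤ runCount S π :=
  Nat.add_le_add (Finset.card_le_card (gluedStarts_subset ..))
    (Finset.card_le_card (gluedStarts_subset ..))

/-- The place of gluing follows a letter of `S`, so no word starts there and the gluing removes
nothing. -/
theorem gluedCount_eq_runCount {S : Finset A} {π : CombData A} (ht : π.topLast ∈ S)
    (hb : π.botLast ∈ S) : gluedCount S π = runCount S π := by
  rw [gluedCount, runCount, gluedStarts_eq _ _ hb, gluedStarts_eq _ _ ht]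

/-- Only the row of the loser moves. The other row ends with the winner, outside `S`, before and
after the step, so its count involves no gluing. -/
theorem gluedCount_rauzyOp_le {S : Finset A} {π : CombData A} (hπ : π.Irreducible)
    (ε : ArrowType) (h : winner ε π ∉ S) : gluedCount S (rauzyOp ε π) ≤ gluedCount S π := by
  have key : ∀ π : CombData A, π.topLast ≠ π.botLast → π.topLast ∉ S →
      gluedCount S (rauzyOp .top π) ≤ gluedCount S π := by
    intro π hne hS
    refine Nat.add_le_add (Finset.card_le_card ?_) (Finset.card_le_card ?_)
    · change gluedStarts π.top S π.topLast _ ⊆ _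
      rw [gluedStarts_eq_of_last_notMem _ _ hS, gluedStarts_eq_of_last_notMem _ _ hS]
    · exact gluedStarts_moveRow_subset π.bot S (bot_botLast π) hne
        (bot_botLast (rauzyOp .top π)) hS
  cases ε
  · exact key π hπ.topLast_ne_botLast h
  · have := key π.swap hπ.topLast_ne_botLast.symm h
    rwa [rauzyOp_swap, gluedCount_swap, gluedCount_swap] at this

theorem runCount_rauzyOp_le [DecidableEq A] {S : Finset A} {π : CombData A} (hπ : π.Irreducible)
    (ht : π.topLast ∈ S) (hb : π.botLast ∈ S) (ε : ArrowType) :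
    runCount S (rauzyOp ε π) ≤ runCount S π ∧
      (¬ ((rauzyOp ε π).topLast ∈ S ∧ (rauzyOp ε π).botLast ∈ S) →
        runCount S (rauzyOp ε π) < runCount S π) := by
  have key : ∀ π : CombData A, π.topLast ≠ π.botLast → π.topLast ∈ S → π.botLast ∈ S →
      runCount S (rauzyOp .top π) ≤ runCount S π ∧
      (¬ ((rauzyOp .top π).topLast ∈ S ∧ (rauzyOp .top π).botLast ∈ S) →
        runCount S (rauzyOp .top π) < runCount S π) := by
    intro π hne ht hb
    have hsub := runStarts_moveRow_subset π.bot S (bot_botLast π) hne ht hb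
    refine ⟨Nat.add_le_add le_rfl (Finset.card_le_card (hsub.trans (Finset.erase_subset _ _))),
      fun hn => Nat.add_lt_add_of_le_of_lt le_rfl ?_⟩
    have hn' : (rauzyOp .top π).botLast ∉ S := fun h => hn ⟨ht, h⟩
    exact (Finset.card_le_card hsub).trans_lt (Finset.card_erase_lt_of_mem
      (mem_runStarts_of_moveRow π.bot S (bot_botLast π) (bot_botLast (rauzyOp .top π)) hb hn'))
  cases ε
  · exact key π hπ.topLast_ne_botLast ht hb
  · have := key π.swap hπ.topLast_ne_botLast.symm hb ht
    rw [rauzyOp_swap, runCount_swap, runCount_swap] at this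
    exact ⟨this.1, fun h => this.2 fun h' => h ⟨h'.2, h'.1⟩⟩

end Comb

section

variable {A : Type*} [Fintype A] [DecidableEq A] [Nontrivial A]

/-! ### Words of arrow types -/

/-- The end of the path that starts at `π` and follows the given arrow types. -/
def runComb : List ArrowType → CombData A → CombData A
  | [], π => π
  | ε :: w, π => runComb w (rauzyOp ε π)

omit [DecidableEq A] in
theorem runComb_append (u v : List ArrowType) (π : CombData A) :
    runComb (u ++ v) π = runComb v (runComb u π) := by
  induction u generalizing π with
  | nil => rfl
  | cons ε u ih => exact ih _

omit [DecidableEq A] in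
theorem runComb_injective (w : List ArrowType) :
    Function.Injective (runComb w : CombData A → CombData A) := by
  induction w with
  | nil => exact Function.injective_id
  | cons ε w ih => exact ih.comp (rauzyOp_injective ε)

/-- A set of irreducible data that is invariant under both operations. -/
structure IsInvariantClass (R : Set (CombData A)) : Prop where
  irreducible : ∀ π ∈ R, π.Irreducible
  rauzyOp_mem : ∀ π ∈ R, ∀ ε, rauzyOp ε π ∈ R

omit [DecidableEq A] in
theorem IsInvariantClass.runComb_mem {R : Set (CombData A)} (hR : IsInvariantClass R)
    (w : List ArrowType) {π : CombData A} (hπ : π ∈ R) : runComb w π ∈ R := by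
  induction w generalizing π with
  | nil => exact hπ
  | cons ε w ih => exact ih (hR.rauzyOp_mem _ hπ ε)

omit [DecidableEq A] in
theorem IsRauzyClass.isInvariantClass {R : Set (CombData A)} (hR : IsRauzyClass R) :
    IsInvariantClass R :=
  ⟨hR.prop.2.1, hR.prop.2.2⟩

omit [DecidableEq A] in
-- The data reachable from `π` form a non-empty invariant subset, which is all of `R` by minimality.
theorem IsRauzyClass.exists_runComb_eq {R : Set (CombData A)} (hR : IsRauzyClass R)
    {π ρ : CombData A} (hπ : π ∈ R) (hρ : ρ ∈ R) : ∃ w, runComb w π = ρ := by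
  have h : R ⊆ Set.range fun w => runComb w π := by
    refine hR.le_of_le (y := Set.range fun w => runComb w π) ⟨⟨π, [], rfl⟩, ?_, ?_⟩ ?_
    · rintro _ ⟨w, rfl⟩
      exact hR.isInvariantClass.irreducible _ (hR.isInvariantClass.runComb_mem w hπ)
    · rintro _ ⟨w, rfl⟩ ε
      exact ⟨w ++ [ε], by simp only [runComb_append]; rfl⟩
    · rintro _ ⟨w, rfl⟩
      exact hR.isInvariantClass.runComb_mem w hπ
  exact h hρ

/-! ### The dual random walk -/

/-- A combinatorial datum with a vector of weights and the list of arrow types followed so far,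
latest first. -/
structure WalkState (A : Type*) [Fintype A] where
  comb : CombData A
  wt : A → ℝ
  hist : List ArrowType

/-- The weights `B q` after an arrow: the weight of the winner is added to that of the loser. -/
def wtStep (ε : ArrowType) (π : CombData A) (q : A → ℝ) : A → ℝ :=
  Function.update q (loser ε π) (q (loser ε π) + q (winner ε π))

def WalkState.step (ε : ArrowType) (s : WalkState A) : WalkState A :=
  ⟨rauzyOp ε s.comb, wtStep ε s.comb s.wt, ε :: s.hist⟩

def WalkState.run : List ArrowType → WalkState A → WalkState A
  | [], s => s
  | ε :: w, s => WalkState.run w (s.step ε)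

/-- The probability of an arrow: the relative weight of the loser. -/
def WalkState.prob (ε : ArrowType) (s : WalkState A) : ℝ :=
  s.wt (loser ε s.comb) / (s.wt (loser ε s.comb) + s.wt (winner ε s.comb))

/-- `Reach G S ρ s`: from `s`, some finite tree of steps of the walk with all leaves in `G ∪ S` has
leaves in `G` of total probability at least `ρ`. -/
inductive Reach (G S : Set (WalkState A)) : ℝ → WalkState A → Prop
  | goal {ρ s} (hs : s ∈ G) (hρ : ρ ≤ 1) : Reach G S ρ s
  | fail {ρ s} (hs : s ∈ S) (hρ : ρ ≤ 0) : Reach G S ρ s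
  | step {ρ s} (r : ArrowType → ℝ) (h : ∀ ε, Reach G S (r ε) (s.step ε))
      (hρ : ρ ≤ s.prob .top * r .top + s.prob .bottom * r .bottom) : Reach G S ρ s

/-- The walk visits only irreducible data, and its weights are positive. -/
def goodStates (R : Set (CombData A)) : Set (WalkState A) :=
  {s | s.comb ∈ R ∧ ∀ ξ, 0 < s.wt ξ}

theorem wtStep_pos {ε : ArrowType} {π : CombData A} {q : A → ℝ} (hq : ∀ ξ, 0 < q ξ) (ξ : A) :
    0 < wtStep ε π q ξ := by
  unfold wtStep
  by_cases h : ξ = loser ε π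
  · subst h; simpa using add_pos (hq _) (hq _)
  · simpa [h] using hq ξ

theorem le_wtStep {ε : ArrowType} {π : CombData A} {q : A → ℝ} (hq : ∀ ξ, 0 < q ξ) (ξ : A) :
    q ξ ≤ wtStep ε π q ξ := by
  unfold wtStep
  by_cases h : ξ = loser ε π
  · subst h; simpa using (hq _).le
  · simp [h]

theorem wtStep_le {ε : ArrowType} {π : CombData A} {q : A → ℝ} {C : ℝ} (hC : 0 ≤ C)
    (hq : ∀ ξ, q ξ ≤ C) (ξ : A) : wtStep ε π q ξ ≤ 2 * C := by
  unfold wtStep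
  by_cases h : ξ = loser ε π
  · subst h; simpa [two_mul] using add_le_add (hq _) (hq _)
  · simp [h]; linarith [hq ξ]

theorem sum_wtStep (ε : ArrowType) (π : CombData A) (q : A → ℝ) :
    ∑ ξ, wtStep ε π q ξ = ∑ ξ, q ξ + q (winner ε π) := by
  rw [← Finset.add_sum_erase _ _ (Finset.mem_univ (loser ε π)),
    ← Finset.add_sum_erase Finset.univ q (Finset.mem_univ (loser ε π))]
  have : ∑ ξ ∈ Finset.univ.erase (loser ε π), wtStep ε π q ξ
      = ∑ ξ ∈ Finset.univ.erase (loser ε π), q ξ :=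
    Finset.sum_congr rfl fun ξ hξ => by simp [wtStep, Finset.ne_of_mem_erase hξ]
  rw [this]
  simp [wtStep]
  ring

theorem WalkState.prob_nonneg {s : WalkState A} (hs : ∀ ξ, 0 < s.wt ξ) (ε : ArrowType) :
    0 ≤ s.prob ε :=
  div_nonneg (hs _).le (add_pos (hs _) (hs _)).le

theorem WalkState.prob_add {s : WalkState A} (hs : ∀ ξ, 0 < s.wt ξ) (ε : ArrowType) :
    s.prob ε + s.prob ε.flip = 1 := by
  unfold WalkState.prob
  rw [winner_flip, loser_flip]
  have := hs (loser ε s.comb)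
  have := hs (winner ε s.comb)
  field_simp
  ring

theorem WalkState.step_mem_goodStates {R : Set (CombData A)} (hR : IsInvariantClass R)
    {s : WalkState A} (hs : s ∈ goodStates R) (ε : ArrowType) : s.step ε ∈ goodStates R :=
  ⟨hR.rauzyOp_mem _ hs.1 ε, wtStep_pos hs.2⟩

theorem WalkState.run_mem_goodStates {R : Set (CombData A)} (hR : IsInvariantClass R)
    (w : List ArrowType) {s : WalkState A} (hs : s ∈ goodStates R) :
    s.run w ∈ goodStates R := by
  induction w generalizing s with
  | nil => exact hs
  | cons ε w ih => exact ih (s.step_mem_goodStates hR hs ε)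

theorem WalkState.run_comb (w : List ArrowType) (s : WalkState A) :
    (s.run w).comb = runComb w s.comb := by
  induction w generalizing s with
  | nil => rfl
  | cons ε w ih => exact ih _

theorem WalkState.run_hist (w : List ArrowType) (s : WalkState A) :
    (s.run w).hist = w.reverse ++ s.hist := by
  induction w generalizing s with
  | nil => rfl
  | cons ε w ih => simp [WalkState.run, ih, WalkState.step]

namespace Reach

variable {R : Set (CombData A)} {G S G' S' : Set (WalkState A)} {ρ : ℝ} {s : WalkState A}

/-- Step of the walk in which the type of the first arrow is not specified. -/
theorem step' (ε : ArrowType) {ρ₁ ρ₂ : ℝ} (h₁ : Reach G S ρ₁ (s.step ε))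
    (h₂ : Reach G S ρ₂ (s.step ε.flip)) (hρ : ρ ≤ s.prob ε * ρ₁ + s.prob ε.flip * ρ₂) :
    Reach G S ρ s := by
  cases ε
  · exact .step (fun | .top => ρ₁ | .bottom => ρ₂) (fun | .top => h₁ | .bottom => h₂) hρ
  · exact .step (fun | .top => ρ₂ | .bottom => ρ₁) (fun | .top => h₂ | .bottom => h₁)
      (by rw [add_comm]; exact hρ)

theorem mono {ρ' : ℝ} (h : Reach G S ρ s) (hρ : ρ' ≤ ρ) : Reach G S ρ' s := by
  cases h with
  | goal hs h => exact .goal hs (hρ.trans h)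
  | fail hs h => exact .fail hs (hρ.trans h)
  | step r h h' => exact .step r h (hρ.trans h')

/-- Composition of trees. -/
theorem bind (hR : IsInvariantClass R) {a b : ℝ} (hab : b ≤ a) (hs : s ∈ goodStates R)
    (h : Reach G S ρ s) (hG : ∀ t ∈ goodStates R, t ∈ G → Reach G' S' a t)
    (hS : ∀ t ∈ goodStates R, t ∈ S → Reach G' S' b t) :
    Reach G' S' (b + ρ * (a - b)) s := by
  induction h with
  | @goal ρ s hsG hρ => exact (hG _ hs hsG).mono (by nlinarith)
  | @fail ρ s hsS hρ => exact (hS _ hs hsS).mono (by nlinarith)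
  | @step ρ s r h hρ ih =>
    refine .step (fun ε => b + r ε * (a - b)) (fun ε => ih ε (s.step_mem_goodStates hR hs ε)) ?_
    -- The two probabilities add up to `1`, so averaging commutes with the affine map `x ↦ b + x (a
    -- - b)`, which is monotone because `b ≤ a`.
    have h1 := WalkState.prob_add hs.2 .top
    simp only [ArrowType.flip] at h1
    have h2 : ρ * (a - b) ≤ (s.prob .top * r .top + s.prob .bottom * r .bottom) * (a - b) :=
      mul_le_mul_of_nonneg_right hρ (by linarith)
    have h3 : s.prob .bottom = 1 - s.prob .top := by linarith
    rw [h3] at h2 ⊢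
    linarith

/-- Composition of trees when nothing is recovered after a failure. -/
theorem bind_mul (hR : IsInvariantClass R) {a : ℝ} (ha : 0 ≤ a) (hs : s ∈ goodStates R)
    (h : Reach G S ρ s) (hG : ∀ t ∈ goodStates R, t ∈ G → Reach G' S' a t)
    (hS : ∀ t ∈ goodStates R, t ∈ S → t ∈ S') :
    Reach G' S' (ρ * a) s := by
  have := h.bind hR ha hs hG fun t ht h => .fail (hS t ht h) le_rfl
  simpa using this

theorem weaken (hR : IsInvariantClass R) (hs : s ∈ goodStates R)
    (h : Reach G S ρ s) (hG : ∀ t ∈ goodStates R, t ∈ G → t ∈ G')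
    (hS : ∀ t ∈ goodStates R, t ∈ S → t ∈ S') :
    Reach G' S' ρ s := by
  have := h.bind_mul (G' := G') (S' := S') hR zero_le_one hs
    (fun t ht h => .goal (hG t ht h) le_rfl) hS
  simpa using this

/-- Meant for a common rescaling of the weights, which leaves the probabilities unchanged. -/
theorem preimage {f : WalkState A → WalkState A} (hf : ∀ ε s, f (s.step ε) = (f s).step ε)
    (hp : ∀ ε s, (f s).prob ε = s.prob ε) (h : Reach G S ρ (f s)) :
    Reach (f ⁻¹' G) (f ⁻¹' S) ρ s := by
  generalize ht : f s = t at h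
  induction h generalizing s with
  | @goal ρ t htG hρ => subst ht; exact .goal htG hρ
  | @fail ρ t htS hρ => subst ht; exact .fail htS hρ
  | @step ρ t r h hρ ih =>
    subst ht
    exact .step r (fun ε => ih ε (hf ε s)) (by simpa only [hp] using hρ)

end Reach

end

/-! ### Raising the weight of a new letter -/

section

variable {A : Type*} [Fintype A] [DecidableEq A] [Nontrivial A]

/-- All losers along the path that starts at `π` and follows the given types are in `S`. -/
def LosersIn (S : Finset A) : List ArrowType → CombData A → Prop
  | [], _ => True
  | ε :: w, π => loser ε π ∈ S ∧ LosersIn S w (rauzyOp ε π)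

theorem losersIn_univ (w : List ArrowType) (π : CombData A) : LosersIn Finset.univ w π := by
  induction w generalizing π with
  | nil => trivial
  | cons ε w ih => exact ⟨Finset.mem_univ _, ih _⟩

theorem winner_mem_of_both {S : Finset A} {π : CombData A} (ht : π.topLast ∈ S)
    (hb : π.botLast ∈ S) (ε : ArrowType) : winner ε π ∈ S := by cases ε <;> assumption

theorem loser_mem_of_both {S : Finset A} {π : CombData A} (ht : π.topLast ∈ S)
    (hb : π.botLast ∈ S) (ε : ArrowType) : loser ε π ∈ S := by cases ε <;> assumption

/-- If both last letters are in `S` and some path has a winner outside `S`, then a path with all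
losers in `S` decreases the number of glued words. -/
theorem exists_gluedCount_lt {R : Set (CombData A)} (hR : IsInvariantClass R) {S : Finset A}
    {π : CombData A} (hπ : π ∈ R) (ht : π.topLast ∈ S) (hb : π.botLast ∈ S)
    (hw : ∃ w ε, winner ε (runComb w π) ∉ S) :
    ∃ w, LosersIn S w π ∧ gluedCount S (runComb w π) < gluedCount S π := by
  obtain ⟨w, ε, hw⟩ := hw
  -- The two counts agree at the start, and gluing can only lower the count at the end.
  suffices h : ∃ w, LosersIn S w π ∧ runCount S (runComb w π) < runCount S π by
    obtain ⟨w, h1, h2⟩ := h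
    exact ⟨w, h1, by
      rw [gluedCount_eq_runCount ht hb]; exact (gluedCount_le_runCount _ _).trans_lt h2⟩
  induction w generalizing π with
  | nil => exact absurd (winner_mem_of_both ht hb ε) hw
  | cons ε' w ih =>
    obtain ⟨h1, h2⟩ := runCount_rauzyOp_le (hR.irreducible π hπ) ht hb ε'
    -- While both last letters stay in `S` the count does not grow; at the first arrow after which
    -- one of them is outside, it drops.
    by_cases h : (rauzyOp ε' π).topLast ∈ S ∧ (rauzyOp ε' π).botLast ∈ S
    · obtain ⟨w', h3, h4⟩ := ih (hR.rauzyOp_mem _ hπ ε') h.1 h.2 hw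
      exact ⟨ε' :: w', ⟨loser_mem_of_both ht hb ε', h3⟩, h4.trans_le h1⟩
    · exact ⟨[ε'], ⟨loser_mem_of_both ht hb ε', trivial⟩, h2 h⟩

theorem WalkState.run_wt_le (w : List ArrowType) {C : ℝ} (hC : 0 ≤ C) {s : WalkState A}
    (hs : ∀ ξ, s.wt ξ ≤ C) (ξ : A) : (s.run w).wt ξ ≤ 2 ^ w.length * C := by
  induction w generalizing s C with
  | nil => simpa [WalkState.run] using hs ξ
  | cons ε w ih =>
    have := ih (C := 2 * C) (by positivity) (s := s.step ε) (wtStep_le hC hs)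
    simp only [WalkState.run, List.length_cons]
    rw [pow_succ, mul_assoc]
    exact this

theorem WalkState.le_run_wt {R : Set (CombData A)} (hR : IsInvariantClass R)
    (w : List ArrowType) {s : WalkState A} (hs : s ∈ goodStates R) (ξ : A) :
    s.wt ξ ≤ (s.run w).wt ξ := by
  induction w generalizing s with
  | nil => exact le_rfl
  | cons ε w ih => exact (le_wtStep hs.2 ξ).trans (ih (s.step_mem_goodStates hR hs ε))

namespace Reach

variable {R : Set (CombData A)}

/-- A given path of bounded length is followed with probability bounded below, if the weights are
bounded and those of the losers are at least `1`. -/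
theorem follow (hR : IsInvariantClass R) (S : Finset A) (n : ℕ) {C : ℝ} (hC : 1 ≤ C) :
    ∃ ρ : ℝ, 0 < ρ ∧ ρ ≤ 1 ∧ ∀ w : List ArrowType, w.length ≤ n → ∀ s ∈ goodStates R,
      LosersIn S w s.comb → (∀ ξ ∈ S, 1 ≤ s.wt ξ) → (∀ ξ, s.wt ξ ≤ C) →
        Reach {s.run w} {t | ∀ ξ, t.wt ξ ≤ 2 ^ n * C} ρ s := by
  induction n generalizing C with
  | zero =>
    refine ⟨1, one_pos, le_rfl, fun w hw s _ _ _ _ => ?_⟩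
    obtain rfl : w = [] := List.length_eq_zero_iff.mp (by omega)
    exact .goal rfl le_rfl
  | succ n ih =>
    obtain ⟨ρ, hρ, hρ1, h⟩ := ih (C := 2 * C) (by linarith)
    have hC' : 0 < 1 + C := by linarith
    have hle : 1 / (1 + C) ≤ 1 := by rw [div_le_one hC']; linarith
    refine ⟨1 / (1 + C) * ρ, by positivity, mul_le_one₀ hle hρ.le hρ1, ?_⟩
    intro w hw s hs hl h1 hsC
    cases w with
    | nil => exact .goal rfl (mul_le_one₀ hle hρ.le hρ1)
    | cons ε w =>
      have hlen : w.length ≤ n := by simpa using hw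
      have hstep := h w hlen (s.step ε) (s.step_mem_goodStates hR hs ε) hl.2
        (fun ξ hξ => (h1 ξ hξ).trans (le_wtStep hs.2 ξ)) (wtStep_le (by linarith) hsC)
      have hpow : (2 : ℝ) ^ (n + 1) * C = 2 ^ n * (2 * C) := by ring
      -- The loser weighs at least `1` and the winner at most `C`.
      have hp : 1 / (1 + C) ≤ s.prob ε := by
        have a1 := h1 _ hl.1
        have a2 := hsC (winner ε s.comb)
        have a3 := hs.2 (winner ε s.comb)
        unfold WalkState.prob
        rw [div_le_div_iff₀ hC' (by linarith)]
        nlinarith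
      rw [hpow]
      refine step' ε (ρ₂ := 0) hstep (.fail ?_ le_rfl) ?_
      · intro ξ
        refine (wtStep_le (by linarith) hsC ξ).trans ?_
        have : (1 : ℝ) ≤ 2 ^ n := one_le_pow₀ (by norm_num)
        nlinarith
      · rw [mul_zero, add_zero]
        exact mul_le_mul_of_nonneg_right hp hρ.le

/-- States at which a letter outside `S` has got weight at least `1`, or the last letters of both
rows are in `S`. -/
def phaseGoal (S : Finset A) (N : ℕ) (L : ℝ) : Set (WalkState A) :=
  {t | (∀ ξ ∈ S, 1 ≤ t.wt ξ) ∧ (∀ ξ, t.wt ξ ≤ 2 * L) ∧ ((∃ ξ, ξ ∉ S ∧ 1 ≤ t.wt ξ) ∨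
    (t.comb.topLast ∈ S ∧ t.comb.botLast ∈ S ∧ gluedCount S t.comb ≤ N))}

/-- A supermartingale argument for the potential `∑_{ξ ∈ S} q_ξ / (q_ξ + L)`, which counts as `0`
once the goal is reached. The number `n` bounds the remaining steps: each one raises the total
weight by the weight of the winner, at least `m`, and the total is at most `d * (2 * L)`. -/
theorem phase_aux (hR : IsInvariantClass R) (S : Finset A) (N : ℕ) {L m : ℝ} (hL : 1 ≤ L)
    (hm : 0 < m) (n : ℕ) : ∀ s ∈ goodStates R, gluedCount S s.comb ≤ N →
      (∀ ξ ∈ S, 1 ≤ s.wt ξ) → (∀ ξ, s.wt ξ ≤ 2 * L) → (∀ ξ, m ≤ s.wt ξ) →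
      Fintype.card A * (2 * L) < ∑ ξ, s.wt ξ + n * m →
      Reach (phaseGoal S N L) {t | ∀ ξ, t.wt ξ ≤ 2 * L}
        (1 - 2 * ∑ ξ ∈ S, s.wt ξ / (s.wt ξ + L)) s := by
  induction n with
  | zero =>
    intro s _ _ _ hsL _ hsum
    have : ∑ ξ, s.wt ξ ≤ ∑ _ξ : A, 2 * L := Finset.sum_le_sum fun ξ _ => hsL ξ
    simp only [Finset.sum_const, Finset.card_univ, nsmul_eq_mul] at this
    simp only [Nat.cast_zero, zero_mul, add_zero] at hsum
    linarith
  | succ n ih =>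
    intro s hs hN h1 hsL hsm hsum
    have hpos : ∀ ξ, 0 < s.wt ξ / (s.wt ξ + L) := fun ξ =>
      div_pos (hs.2 ξ) (by linarith [hs.2 ξ])
    have hU : 0 ≤ ∑ ξ ∈ S, s.wt ξ / (s.wt ξ + L) := Finset.sum_nonneg fun ξ _ => (hpos ξ).le
    by_cases hnew : ∃ ξ, ξ ∉ S ∧ 1 ≤ s.wt ξ
    · exact .goal ⟨h1, hsL, .inl hnew⟩ (by linarith)
    push Not at hnew
    by_cases hbig : ∃ ξ ∈ S, L ≤ s.wt ξ
    · obtain ⟨ξ, hξ, hLξ⟩ := hbig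
      -- One weight of at least `L` makes the potential at least `1 / 2`, so the promised
      -- probability is not positive.
      refine .fail hsL ?_
      have a1 : 1 / 2 ≤ s.wt ξ / (s.wt ξ + L) := by
        rw [div_le_div_iff₀ (by norm_num) (by linarith)]
        linarith
      have a2 := Finset.single_le_sum (f := fun ξ => s.wt ξ / (s.wt ξ + L))
        (fun ξ _ => (hpos ξ).le) hξ
      linarith
    push Not at hbig
    by_cases hboth : s.comb.topLast ∈ S ∧ s.comb.botLast ∈ S
    · exact .goal ⟨h1, hsL, .inr ⟨hboth.1, hboth.2, hN⟩⟩ (by linarith)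
    have hleL : ∀ ξ, s.wt ξ ≤ L := fun ξ => by
      by_cases h : ξ ∈ S
      · exact (hbig ξ h).le
      · exact (hnew ξ h).le.trans hL
    have hrec : ∀ ε, winner ε s.comb ∉ S → Reach (phaseGoal S N L) {t | ∀ ξ, t.wt ξ ≤ 2 * L}
        (1 - 2 * ∑ ξ ∈ S, (s.step ε).wt ξ / ((s.step ε).wt ξ + L)) (s.step ε) := by
      intro ε hε
      refine ih _ (s.step_mem_goodStates hR hs ε)
        ((gluedCount_rauzyOp_le (hR.irreducible _ hs.1) ε hε).trans hN)
        (fun ξ hξ => (h1 ξ hξ).trans (le_wtStep hs.2 ξ)) (wtStep_le (by linarith) hleL)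
        (fun ξ => (hsm ξ).trans (le_wtStep hs.2 ξ)) ?_
      have a1 : ∑ ξ, (s.step ε).wt ξ = _ := sum_wtStep ε s.comb s.wt
      rw [a1]
      push_cast at hsum
      have a2 := hsm (winner ε s.comb)
      linarith
    have hstay : ∀ ε ξ, ξ ≠ loser ε s.comb → (s.step ε).wt ξ = s.wt ξ := fun ε ξ h => by
      simp [WalkState.step, wtStep, h]
    by_cases hmix : ∃ ε, winner ε s.comb ∈ S ∧ loser ε s.comb ∉ S
    · obtain ⟨ε, hw, hl⟩ := hmix
      -- One last letter is in `S`. If it wins, the loser outside `S` receives its weight, at least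
      -- `1`; otherwise it loses and only its term of the potential changes.
      refine step' ε (ρ₁ := 1) (.goal ⟨fun ξ hξ => (h1 ξ hξ).trans (le_wtStep hs.2 ξ),
        wtStep_le (by linarith) hleL, .inl ⟨loser ε s.comb, hl, ?_⟩⟩ le_rfl)
        (hrec ε.flip (by simpa using hl)) ?_
      · simp only [WalkState.step, wtStep, Function.update_self]
        linarith [h1 _ hw, hs.2 (loser ε s.comb)]
      · have hp := WalkState.prob_add hs.2 ε
        set p := s.prob ε.flip with hpdef
        have hp0 : 0 ≤ p := s.prob_nonneg hs.2 _
        have hp1 : p ≤ 1 := by linarith [s.prob_nonneg hs.2 ε]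
        have key : p * ∑ ξ ∈ S, (s.step ε.flip).wt ξ / ((s.step ε.flip).wt ξ + L) ≤
            ∑ ξ ∈ S, s.wt ξ / (s.wt ξ + L) := by
          rw [Finset.mul_sum]
          refine Finset.sum_le_sum fun ξ hξ => ?_
          by_cases hξw : ξ = winner ε s.comb
          · subst hξw
            have b1 := hs.2 (winner ε s.comb)
            have b2 := hs.2 (loser ε s.comb)
            simp only [WalkState.step, wtStep, hpdef, WalkState.prob, winner_flip, loser_flip,
              Function.update_self]
            -- With `w`, `l` the weights of this letter and of its rival, `w / (w + l) * ((w + l) /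
            -- (w + l + L)) = w / (w + l + L)`, which is at most `w / (w + L)`.
            rw [div_mul_div_comm, div_le_div_iff₀ (by positivity) (by positivity)]
            have : 0 ≤ s.wt (winner ε s.comb) * (s.wt (winner ε s.comb) + s.wt (loser ε s.comb)) *
              s.wt (loser ε s.comb) := by positivity
            nlinarith
          · rw [hstay _ _ (by simpa using hξw)]
            exact mul_le_of_le_one_left (hpos ξ).le hp1
        have : s.prob ε = 1 - p := by linarith
        rw [this]
        nlinarith
    · push Not at hmix
      have hout : ∀ ε, winner ε s.comb ∉ S := by
        intro ε hε
        have h2 := hmix ε hε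
        apply hboth
        cases ε
        exacts [⟨hε, h2⟩, ⟨h2, hε⟩]
      have hval : ∀ ε, ∑ ξ ∈ S, (s.step ε).wt ξ / ((s.step ε).wt ξ + L) =
          ∑ ξ ∈ S, s.wt ξ / (s.wt ξ + L) := fun ε =>
        Finset.sum_congr rfl fun ξ hξ => by
          rw [hstay ε ξ]
          rintro rfl
          exact hout ε.flip (by simpa using hξ)
      refine step' .top (hrec _ (hout _)) (hrec _ (hout _)) ?_
      rw [hval, hval, ← add_mul, WalkState.prob_add hs.2, one_mul]

/-- With probability at least `1/2`, a letter outside `S` gets weight at least `1`, or two letters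
of `S` compete, before the weights have grown by a large factor. -/
theorem phase (hR : IsInvariantClass R) (S : Finset A) (N : ℕ) {C : ℝ} (hC : 1 ≤ C)
    {s : WalkState A} (hs : s ∈ goodStates R) (hN : gluedCount S s.comb ≤ N)
    (h1 : ∀ ξ ∈ S, 1 ≤ s.wt ξ) (hsC : ∀ ξ, s.wt ξ ≤ C) :
    Reach (phaseGoal S N (4 * Fintype.card A * C))
      {t | ∀ ξ, t.wt ξ ≤ 2 * (4 * Fintype.card A * C)} (1 / 2) s := by
  have hd : (1 : ℝ) ≤ Fintype.card A := by exact_mod_cast Fintype.card_pos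
  set d : ℝ := ((Fintype.card A : ℕ) : ℝ)
  have hL : 1 ≤ 4 * d * C := by nlinarith
  have hCL : C ≤ 4 * d * C := by nlinarith
  obtain ⟨x, hx⟩ := Finite.exists_min s.wt
  have hm := hs.2 x
  obtain ⟨n, hn⟩ := exists_nat_gt (d * (2 * (4 * d * C)) / s.wt x)
  refine (phase_aux hR S N hL hm n s hs hN h1 (fun ξ => (hsC ξ).trans (by linarith)) hx ?_).mono ?_
  · rw [div_lt_iff₀ hm] at hn
    have : 0 ≤ ∑ ξ, s.wt ξ := Finset.sum_nonneg fun ξ _ => (hs.2 ξ).le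
    linarith
  · have a1 : ∀ ξ ∈ S, s.wt ξ / (s.wt ξ + 4 * d * C) ≤ 1 / (4 * d) := by
      intro ξ _
      have := hs.2 ξ
      have := hsC ξ
      rw [div_le_div_iff₀ (by linarith) (by linarith)]
      nlinarith
    have a2 := Finset.sum_le_card_nsmul _ _ _ a1
    have a3 : (S.card : ℝ) ≤ d := Nat.cast_le.mpr (Finset.card_le_univ S)
    have a4 : S.card • (1 / (4 * d)) ≤ 1 / 4 := by
      rw [nsmul_eq_mul, mul_one_div, div_le_div_iff₀ (by linarith) (by norm_num)]
      linarith
    linarith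

end Reach

theorem exists_uniform {ι : Type*} [Finite ι] {P : ι → ℝ → ℝ → Prop}
    (hP : ∀ i ρ ρ' K K', P i ρ K → ρ' ≤ ρ → K ≤ K' → P i ρ' K')
    (h : ∀ i, ∃ ρ K, 0 < ρ ∧ P i ρ K) : ∃ ρ K, 0 < ρ ∧ ∀ i, P i ρ K := by
  choose ρ K hρ h using h
  obtain ⟨a, ha⟩ := (Set.finite_range K).bddAbove
  obtain ⟨b, hb⟩ := (Set.finite_range fun i => (ρ i)⁻¹).bddAbove
  -- The maximum with `1` keeps the constant positive even for an empty index type.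
  refine ⟨(max b 1)⁻¹, a, by positivity, fun i => hP i _ _ _ _ (h i) ?_ (ha ⟨i, rfl⟩)⟩
  have : (ρ i)⁻¹ ≤ max b 1 := (hb ⟨i, rfl⟩).trans (le_max_left _ _)
  exact inv_le_of_inv_le₀ (hρ i) this

end

/-! ### From one new letter to balanced weights and to a prescribed word -/

section

variable {A : Type*} [Fintype A] [DecidableEq A] [Nontrivial A]

/-- Every letter is the winner of some arrow on some path from every datum. -/
def EveryLetterWins (R : Set (CombData A)) : Prop :=
  ∀ π ∈ R, ∀ ξ, ∃ w ε, winner ε (runComb w π) = ξ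

namespace Reach

variable {R : Set (CombData A)}

/-- Induction on the bound for the glued count. A phase gives either a new letter or two competing
letters of `S`; in the latter case a path with losers in `S`, whose weights are at least `1`, is
followed with probability bounded below, and it lowers the count. -/
theorem new_letter (hR : IsInvariantClass R) (hw : EveryLetterWins R) {S : Finset A}
    (hS : ∃ ξ, ξ ∉ S) (N : ℕ) : ∀ {C : ℝ}, 1 ≤ C → ∃ ρ K : ℝ, 0 < ρ ∧ ∀ s ∈ goodStates R,
      gluedCount S s.comb < N → (∀ ξ ∈ S, 1 ≤ s.wt ξ) → (∀ ξ, s.wt ξ ≤ C) →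
      Reach {t | (∀ ξ ∈ S, 1 ≤ t.wt ξ) ∧ (∃ ξ, ξ ∉ S ∧ 1 ≤ t.wt ξ) ∧ ∀ ξ, t.wt ξ ≤ K}
        {t | ∀ ξ, t.wt ξ ≤ K} ρ s := by
  induction N with
  | zero => exact fun _ => ⟨1, 0, one_pos, fun s _ h => absurd h (Nat.not_lt_zero _)⟩
  | succ N ih =>
    intro C hC
    obtain ⟨y, hy⟩ := hS
    have hplan : ∃ n : ℕ, ∀ π ∈ R, π.topLast ∈ S → π.botLast ∈ S →
        ∃ w, w.length ≤ n ∧ LosersIn S w π ∧ gluedCount S (runComb w π) < gluedCount S π := by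
      have : ∀ π : CombData A, ∃ w : List ArrowType, π ∈ R → π.topLast ∈ S → π.botLast ∈ S →
          LosersIn S w π ∧ gluedCount S (runComb w π) < gluedCount S π := by
        intro π
        by_cases h : π ∈ R ∧ π.topLast ∈ S ∧ π.botLast ∈ S
        · obtain ⟨w, ε, hwy⟩ := hw π h.1 y
          obtain ⟨w', h'⟩ := exists_gluedCount_lt hR h.1 h.2.1 h.2.2 ⟨w, ε, hwy ▸ hy⟩
          exact ⟨w', fun _ _ _ => h'⟩
        · exact ⟨[], fun h1 h2 h3 => absurd ⟨h1, h2, h3⟩ h⟩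
      choose w hw' using this
      obtain ⟨n, hn⟩ := (Set.finite_range fun π => (w π).length).bddAbove
      exact ⟨n, fun π h1 h2 h3 => ⟨w π, hn ⟨π, rfl⟩, hw' π h1 h2 h3⟩⟩
    obtain ⟨n, hn⟩ := hplan
    have hd : (1 : ℝ) ≤ Fintype.card A := by exact_mod_cast Fintype.card_pos
    set L : ℝ := 4 * Fintype.card A * C with hLdef
    have hL : 1 ≤ 2 * L := by nlinarith
    obtain ⟨ρ₁, hρ₁, hρ₁', hfollow⟩ := follow hR S n hL
    have hpow : (1 : ℝ) ≤ 2 ^ n := one_le_pow₀ (by norm_num)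
    have hC2 : 2 * L ≤ 2 ^ n * (2 * L) := le_mul_of_one_le_left (by linarith) hpow
    obtain ⟨ρ₂, K, hρ₂, hih⟩ := ih (hL.trans hC2)
    refine ⟨1 / 2 * min 1 (ρ₁ * ρ₂), max (2 ^ n * (2 * L)) K, by positivity, ?_⟩
    intro s hs hsN h1 hsC
    refine (phase hR S N hC hs (by omega) h1 hsC).bind_mul hR (by positivity) hs ?_
      fun t _ h ξ => (h ξ).trans (hC2.trans (le_max_left _ _))
    rintro t ht ⟨ht1, htL, hnew | ⟨htop, hbot, hcount⟩⟩
    · exact .goal ⟨ht1, hnew, fun ξ => (htL ξ).trans (hC2.trans (le_max_left _ _))⟩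
        (min_le_left _ _)
    · obtain ⟨w, hwn, hwl, hwc⟩ := hn t.comb ht.1 htop hbot
      refine Reach.mono (ρ := ρ₁ * ρ₂) ?_ (min_le_right _ _)
      refine (hfollow w hwn t ht hwl ht1 htL).bind_mul hR hρ₂.le ht ?_
        fun t _ h ξ => (h ξ).trans (le_max_left _ _)
      rintro _ ht' rfl
      refine (hih _ ht' (by rw [WalkState.run_comb]; omega)
        (fun ξ hξ => (ht1 ξ hξ).trans (WalkState.le_run_wt hR w ht ξ)) fun ξ =>
          (WalkState.run_wt_le w (by linarith) htL ξ).trans ?_).weaken hR ht' ?_ ?_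
      · gcongr
        norm_num
      · exact fun t _ h => ⟨h.1, h.2.1, fun ξ => (h.2.2 ξ).trans (le_max_right _ _)⟩
      · exact fun t _ h ξ => (h ξ).trans (le_max_right _ _)

/-- The letters that get weight `1` are added to `S` one by one. Which letter comes next depends on
the branch, so the constants are made uniform over all letters outside `S`. -/
theorem balanced_of_subset (hR : IsInvariantClass R) (hw : EveryLetterWins R) (k : ℕ) :
    ∀ {C : ℝ}, 1 ≤ C → ∀ S : Finset A, Sᶜ.card ≤ k → ∃ ρ K : ℝ, 0 < ρ ∧ ∀ s ∈ goodStates R,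
      (∀ ξ ∈ S, 1 ≤ s.wt ξ) → (∀ ξ, s.wt ξ ≤ C) →
      Reach {t | (∀ ξ, 1 ≤ t.wt ξ) ∧ ∀ ξ, t.wt ξ ≤ K} {t | ∀ ξ, t.wt ξ ≤ K} ρ s := by
  induction k with
  | zero =>
    intro C _ S hS
    have : S = Finset.univ := by simpa using hS
    subst this
    exact ⟨1, C, one_pos, fun s _ h1 h2 => .goal ⟨fun ξ => h1 ξ (Finset.mem_univ ξ), h2⟩ le_rfl⟩
  | succ k ih =>
    intro C hC S hS
    by_cases hSu : ∃ ξ, ξ ∉ S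
    swap
    · push Not at hSu
      exact ⟨1, C, one_pos, fun s _ h1 h2 => .goal ⟨fun ξ => h1 ξ (hSu ξ), h2⟩ le_rfl⟩
    have hbound : ∃ N, ∀ π : CombData A, gluedCount S π < N := by
      obtain ⟨N, hN⟩ := (Set.finite_range fun π : CombData A => gluedCount S π).bddAbove
      exact ⟨N + 1, fun π => Nat.lt_succ_of_le (hN (Set.mem_range_self π))⟩
    obtain ⟨N, hN⟩ := hbound
    obtain ⟨ρ₁, K₁, hρ₁, hnew⟩ := new_letter hR hw hSu N hC
    have huni : ∃ ρ K : ℝ, 0 < ρ ∧ ∀ y : {y // y ∉ S}, 0 ≤ ρ → ∀ s ∈ goodStates R,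
        (∀ ξ ∈ insert y.1 S, 1 ≤ s.wt ξ) → (∀ ξ, s.wt ξ ≤ max 1 K₁) →
        Reach {t | (∀ ξ, 1 ≤ t.wt ξ) ∧ ∀ ξ, t.wt ξ ≤ K} {t | ∀ ξ, t.wt ξ ≤ K} ρ s := by
      refine exists_uniform ?_ fun y => ?_
      · intro y ρ ρ' K K' h hρ hK hρ' s hs h1 h2
        refine Reach.mono ?_ hρ
        exact (h (hρ'.trans hρ) s hs h1 h2).weaken hR hs
          (fun t _ h => ⟨h.1, fun ξ => (h.2 ξ).trans hK⟩) fun t _ h ξ => (h ξ).trans hK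
      · obtain ⟨ρ, K, hρ, h⟩ := ih (le_max_left 1 K₁) (insert y.1 S) (by
          rw [Finset.compl_insert, Finset.card_erase_of_mem (by simpa using y.2)]; omega)
        exact ⟨ρ, K, hρ, fun _ => h⟩
    obtain ⟨ρ₂, K₂, hρ₂, hnext⟩ := huni
    refine ⟨ρ₁ * ρ₂, max K₁ K₂, by positivity, fun s hs h1 hsC => ?_⟩
    refine (hnew s hs (hN _) h1 hsC).bind_mul hR hρ₂.le hs ?_
      fun t _ h ξ => (h ξ).trans (le_max_left _ _)
    rintro t ht ⟨ht1, ⟨y, hy, hy1⟩, htK⟩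
    refine (hnext ⟨y, hy⟩ hρ₂.le t ht ?_ fun ξ => (htK ξ).trans (le_max_right _ _)).weaken hR ht
      (fun t _ h => ⟨h.1, fun ξ => (h.2 ξ).trans (le_max_right _ _)⟩)
      (fun t _ h ξ => (h ξ).trans (le_max_right _ _))
    intro ξ hξ
    rcases Finset.mem_insert.mp hξ with rfl | h
    exacts [hy1, ht1 ξ h]

/-- States whose history ends with the word `v`, at the datum `π`, with weights at most `K`. -/
def wordGoal (π : CombData A) (v : List ArrowType) (K : ℝ) : Set (WalkState A) :=
  {t | t.comb = π ∧ (∃ h, t.hist = v.reverse ++ h) ∧ ∀ ξ, t.wt ξ ≤ K}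

/-- For `S = ∅` there is no lower bound to check at the start. Once all weights lie between `1` and
a constant, a path of bounded length that ends with `v` has probability bounded below. -/
theorem word_of_le_one (hR : IsInvariantClass R) (hw : EveryLetterWins R)
    {π : CombData A} {v : List ArrowType}
    (hv : ∀ π' ∈ R, ∃ u, runComb (u ++ v) π' = π) :
    ∃ ρ K : ℝ, 0 < ρ ∧ ∀ s ∈ goodStates R, (∀ ξ, s.wt ξ ≤ 1) →
      Reach (wordGoal π v K) {t | ∀ ξ, t.wt ξ ≤ K} ρ s := by
  obtain ⟨ρ₁, K₁, hρ₁, h⟩ := balanced_of_subset hR hw _ le_rfl ∅ le_rfl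
  have hlen : ∃ n : ℕ, ∀ π' ∈ R, ∃ u, (u ++ v).length ≤ n ∧ runComb (u ++ v) π' = π := by
    have : ∀ π' : CombData A, ∃ u, π' ∈ R → runComb (u ++ v) π' = π := fun π' => by
      by_cases h : π' ∈ R
      · exact (hv π' h).imp fun u hu _ => hu
      · exact ⟨[], fun h' => absurd h' h⟩
    choose u hu using this
    obtain ⟨n, hn⟩ := (Set.finite_range fun π => (u π ++ v).length).bddAbove
    exact ⟨n, fun π h => ⟨u π, hn ⟨π, rfl⟩, hu π h⟩⟩
  obtain ⟨n, hn⟩ := hlen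
  have hpow : (1 : ℝ) ≤ 2 ^ n := one_le_pow₀ (by norm_num)
  obtain ⟨ρ₂, hρ₂, -, hfollow⟩ := follow hR Finset.univ n (le_max_left 1 K₁)
  have hK : K₁ ≤ 2 ^ n * max 1 K₁ := by
    have := le_max_right 1 K₁
    have := le_max_left 1 K₁
    nlinarith
  refine ⟨ρ₁ * ρ₂, 2 ^ n * max 1 K₁, by positivity, fun s hs hs1 => ?_⟩
  refine (h s hs (by simp) hs1).bind_mul hR hρ₂.le hs ?_ fun t _ h ξ => (h ξ).trans hK
  rintro t ht ⟨ht1, htK⟩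
  obtain ⟨u, hu1, hu2⟩ := hn t.comb ht.1
  have htK' := fun ξ => (htK ξ).trans (le_max_right 1 K₁)
  refine (hfollow _ hu1 t ht (losersIn_univ _ _) (fun ξ _ => ht1 ξ) htK').weaken hR ht ?_
    fun t _ h => h
  rintro _ _ rfl
  refine ⟨by rw [WalkState.run_comb, hu2], ⟨u.reverse ++ t.hist, ?_⟩, fun ξ => ?_⟩
  · simp [WalkState.run_hist]
  · refine (WalkState.run_wt_le _ (by positivity) htK' ξ).trans ?_
    gcongr
    norm_num

/-- The walk is homogeneous in the weights, so the case `u = 1` suffices and the constants do not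
depend on `u`. -/
theorem word_of_le (hR : IsInvariantClass R) (hw : EveryLetterWins R)
    {π : CombData A} {v : List ArrowType}
    (hv : ∀ π' ∈ R, ∃ u, runComb (u ++ v) π' = π) :
    ∃ ρ K : ℝ, 0 < ρ ∧ ∀ u : ℝ, 0 < u → ∀ s ∈ goodStates R, (∀ ξ, s.wt ξ ≤ u) →
      Reach (wordGoal π v (K * u)) {t | ∀ ξ, t.wt ξ ≤ K * u} ρ s := by
  obtain ⟨ρ, K, hρ, h⟩ := word_of_le_one hR hw hv
  refine ⟨ρ, K, hρ, fun u hu s hs hsu => ?_⟩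
  have hu' : 0 < u⁻¹ := inv_pos.mpr hu
  have hle : ∀ a b : ℝ, u⁻¹ * a ≤ b ↔ a ≤ b * u := fun a b => by
    rw [inv_mul_le_iff₀ hu, mul_comm]
  let f : WalkState A → WalkState A := fun t => ⟨t.comb, fun ξ => u⁻¹ * t.wt ξ, t.hist⟩
  have h1 := h (f s) ⟨hs.1, fun ξ => mul_pos hu' (hs.2 ξ)⟩ fun ξ => by
    simp only [f, hle, one_mul]; exact hsu ξ
  have h2 := h1.preimage (f := f) ?_ ?_
  · refine h2.weaken hR hs ?_ ?_
    · rintro t - ⟨h3, h4, h5⟩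
      exact ⟨h3, h4, fun ξ => (hle _ _).mp (h5 ξ)⟩
    · rintro t - h5 ξ
      exact (hle _ _).mp (h5 ξ)
  · intro ε t
    simp only [f, WalkState.step, WalkState.mk.injEq, true_and, and_true]
    funext ξ
    by_cases h : ξ = loser ε t.comb
    · subst h; simp [wtStep, mul_add]
    · simp [wtStep, h]
  · intro ε t
    simp only [f, WalkState.prob]
    rw [← mul_add, mul_div_mul_left _ _ hu'.ne']

/-- The probability that the word `v` does not occur before the weights have grown by the factor
`K ^ k` decreases exponentially with `k`. -/
theorem word_iterate (hR : IsInvariantClass R) (hw : EveryLetterWins R)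
    {π : CombData A} {v : List ArrowType}
    (hv : ∀ π' ∈ R, ∃ u, runComb (u ++ v) π' = π) :
    ∃ ρ K : ℝ, 0 < ρ ∧ ρ < 1 ∧ 1 < K ∧ ∀ (k : ℕ) (u : ℝ), 0 < u → ∀ s ∈ goodStates R,
      (∀ ξ, s.wt ξ ≤ u) → Reach (wordGoal π v (K ^ k * u)) {t | ∀ ξ, t.wt ξ ≤ K ^ k * u}
        (1 - (1 - ρ) ^ k) s := by
  obtain ⟨ρ₀, K₀, hρ₀, h₀⟩ := word_of_le hR hw hv
  obtain ⟨ρ, hρ, hρ1, hρρ⟩ : ∃ ρ : ℝ, 0 < ρ ∧ ρ < 1 ∧ ρ ≤ ρ₀ :=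
    ⟨min ρ₀ (1 / 2), by positivity, (min_le_right _ _).trans_lt (by norm_num), min_le_left _ _⟩
  obtain ⟨K, hK1, hK⟩ : ∃ K : ℝ, 1 < K ∧ K₀ ≤ K :=
    ⟨max K₀ 2, one_lt_two.trans_le (le_max_right _ _), le_max_left _ _⟩
  refine ⟨ρ, K, hρ, hρ1, hK1, fun k => ?_⟩
  induction k with
  | zero => exact fun u _ s _ hsu => .fail (by simpa using hsu) (by simp)
  | succ k ih =>
    intro u hu s hs hsu
    have hKu : K₀ * u ≤ K * u := by gcongr
    have hpow : K ^ (k + 1) * u = K ^ k * (K * u) := by ring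
    have hle : K * u ≤ K ^ k * (K * u) :=
      le_mul_of_one_le_left (by positivity) (one_le_pow₀ hK1.le)
    rw [hpow]
    have hb : 0 ≤ (1 - ρ) ^ k := pow_nonneg (by linarith) k
    -- One trial from scale `u`; after a failure, `k` further trials from scale `K * u`.
    refine Reach.mono (ρ := 1 - (1 - ρ) ^ k + ρ * (1 - (1 - (1 - ρ) ^ k))) ?_
      (by rw [pow_succ]; nlinarith)
    refine ((h₀ u hu s hs hsu).mono hρρ).bind hR (by linarith) hs
      (fun t _ ht => .goal ⟨ht.1, ht.2.1, fun ξ => ?_⟩ le_rfl)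
      (fun t ht htS => ih (K * u) (by positivity) t ht fun ξ => (htS ξ).trans hKu)
    exact (ht.2.2 ξ).trans (hKu.trans hle)

end Reach

end

section

variable {A : Type*} [Fintype A] [DecidableEq A] [Nontrivial A]

/-! ### Lebesgue measure and the walk -/

/-- The lengths after a step of the given type. -/
def lamStep (ε : ArrowType) (π : CombData A) (lam : A → ℝ) : A → ℝ :=
  Function.update lam (winner ε π) (lam (winner ε π) - lam (loser ε π))

/-- The inverse of `lamStep`. -/
def lamBack (ε : ArrowType) (π : CombData A) (lam : A → ℝ) : A → ℝ :=
  Function.update lam (winner ε π) (lam (winner ε π) + lam (loser ε π))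

theorem lamStep_lamBack {ε : ArrowType} {π : CombData A} (h : π.Irreducible) (lam : A → ℝ) :
    lamStep ε π (lamBack ε π lam) = lam := by
  have := (h.winner_ne_loser ε).symm
  simp [lamStep, lamBack, this]

theorem lamBack_eq {ε : ArrowType} {π : CombData A} :
    lamBack ε π = Matrix.toLin' (transvection (winner ε π) (loser ε π) (1 : ℝ)) := by
  funext lam ξ
  rw [Matrix.toLin'_apply, transvection, add_mulVec, one_mulVec]
  by_cases h : ξ = winner ε π
  · subst h; simp [lamBack, Matrix.single_mulVec]
  · simp [lamBack, Matrix.single_mulVec, h]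

theorem volume_image_lamBack {ε : ArrowType} {π : CombData A} (h : π.Irreducible)
    (E : Set (A → ℝ)) : volume (lamBack ε π '' E) = volume E := by
  rw [lamBack_eq, Measure.addHaar_image_linearMap, LinearMap.det_toLin',
    det_transvection_of_ne _ _ (h.winner_ne_loser ε)]
  simp

/-- The simplex of positive vectors on which the linear form with coefficients `q` is less
than `1`. -/
def weightSimplex (q : A → ℝ) : Set (A → ℝ) :=
  {lam | (∀ ξ, 0 < lam ξ) ∧ ∑ ξ, q ξ * lam ξ < 1}

theorem volume_weightSimplex_one_lt_top : volume (weightSimplex (1 : A → ℝ)) < ⊤ := by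
  have hsub : weightSimplex (1 : A → ℝ) ⊆ Set.pi Set.univ fun _ => Set.Ioo 0 1 := by
    intro lam hlam ξ _
    refine ⟨hlam.1 ξ, lt_of_le_of_lt ?_ hlam.2⟩
    simpa using Finset.single_le_sum (f := lam) (fun ξ _ => (hlam.1 ξ).le) (Finset.mem_univ ξ)
  refine (measure_mono hsub).trans_lt ?_
  rw [volume_pi_pi]
  simp

theorem volume_weightSimplex {q : A → ℝ} (hq : ∀ ξ, 0 < q ξ) :
    volume (weightSimplex q) =
      ENNReal.ofReal (∏ ξ, q ξ)⁻¹ * volume (weightSimplex (1 : A → ℝ)) := by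
  have hprod : 0 < ∏ ξ, q ξ := Finset.prod_pos fun ξ _ => hq ξ
  have hdet : LinearMap.det (Matrix.toLin' (diagonal q)) = ∏ ξ, q ξ := by
    rw [LinearMap.det_toLin', det_diagonal]
  have hpre : weightSimplex q = Matrix.toLin' (diagonal q) ⁻¹' weightSimplex 1 := by
    ext lam
    simp only [weightSimplex, Set.mem_preimage, Matrix.toLin'_apply, Set.mem_ofPred_eq,
      mulVec_diagonal, Pi.one_apply, one_mul]
    simp [hq]
  rw [hpre, Measure.addHaar_preimage_linearMap _ (by rw [hdet]; exact hprod.ne'), hdet,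
    abs_of_pos (inv_pos.mpr hprod)]

/-- Only the weight `l` of the loser changes, to `l + w`, so the inverse product is multiplied by `l
/ (l + w)`. This is the reason for the definition of `WalkState.prob`. -/
theorem volume_weightSimplex_step {s : WalkState A} (hs : ∀ ξ, 0 < s.wt ξ) (ε : ArrowType) :
    volume (weightSimplex (s.step ε).wt) =
      ENNReal.ofReal (s.prob ε) * volume (weightSimplex s.wt) := by
  have h1 := hs (loser ε s.comb)
  have h2 := hs (winner ε s.comb)
  rw [show (s.step ε).wt = wtStep ε s.comb s.wt from rfl,
    volume_weightSimplex (wtStep_pos hs), volume_weightSimplex hs, ← mul_assoc,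
    ← ENNReal.ofReal_mul (s.prob_nonneg hs ε)]
  congr 2
  have hP : 0 < ∏ ξ ∈ Finset.univ.erase (loser ε s.comb), s.wt ξ :=
    Finset.prod_pos fun ξ _ => hs ξ
  have h3 : ∏ ξ ∈ Finset.univ.erase (loser ε s.comb), wtStep ε s.comb s.wt ξ
      = ∏ ξ ∈ Finset.univ.erase (loser ε s.comb), s.wt ξ :=
    Finset.prod_congr rfl fun ξ hξ => by simp [wtStep, Finset.ne_of_mem_erase hξ]
  have h4 : wtStep ε s.comb s.wt (loser ε s.comb) =
      s.wt (loser ε s.comb) + s.wt (winner ε s.comb) := by simp [wtStep]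
  rw [← Finset.mul_prod_erase _ _ (Finset.mem_univ (loser ε s.comb)), h3, h4,
    ← Finset.mul_prod_erase _ s.wt (Finset.mem_univ (loser ε s.comb)), WalkState.prob]
  field_simp

/-- The induction steps given by the length vector lead the walk from the state into `G`. -/
inductive Hits (G : Set (WalkState A)) : WalkState A → (A → ℝ) → Prop
  | here {s lam} (hs : s ∈ G) : Hits G s lam
  | next {s lam} (ε : ArrowType) (h : lam (loser ε s.comb) < lam (winner ε s.comb))
      (h' : Hits G (s.step ε) (lamStep ε s.comb lam)) : Hits G s lam

/-- Inverse induction is `B^*` on lengths, and `⟨q, B^* λ⟩ = ⟨B q, λ⟩`, so the simplex of the new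
weights is carried into the part of the old one where this arrow is taken. -/
theorem lamBack_mem {G : Set (WalkState A)} {s : WalkState A} (hs : s.comb.Irreducible)
    {ε : ArrowType} {lam : A → ℝ} (h : lam ∈ weightSimplex (s.step ε).wt ∩ {x | Hits G (s.step ε) x}) :
    lamBack ε s.comb lam ∈ (weightSimplex s.wt ∩ {x | Hits G s x}) ∩
      {x | x (loser ε s.comb) < x (winner ε s.comb)} := by
  obtain ⟨⟨hpos, hsum⟩, hhit⟩ := h
  have hne := (hs.winner_ne_loser ε).symm
  have hlt : lamBack ε s.comb lam (loser ε s.comb) < lamBack ε s.comb lam (winner ε s.comb) := by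
    simp [lamBack, hne, hpos]
  refine ⟨⟨⟨fun ξ => ?_, ?_⟩, .next ε hlt (by rwa [lamStep_lamBack hs])⟩, hlt⟩
  · by_cases h : ξ = winner ε s.comb
    · subst h; simpa [lamBack] using add_pos (hpos _) (hpos _)
    · simpa [lamBack, h] using hpos ξ
  · refine lt_of_eq_of_lt ?_ hsum
    have e1 : ∀ ξ, s.wt ξ * lamBack ε s.comb lam ξ = s.wt ξ * lam ξ +
        if ξ = winner ε s.comb then s.wt (winner ε s.comb) * lam (loser ε s.comb) else 0 := by
      intro ξ
      by_cases h : ξ = winner ε s.comb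
      · subst h; simp [lamBack, mul_add]
      · simp [lamBack, h]
    have e2 : ∀ ξ, (s.step ε).wt ξ * lam ξ = s.wt ξ * lam ξ +
        if ξ = loser ε s.comb then s.wt (winner ε s.comb) * lam (loser ε s.comb) else 0 := by
      intro ξ
      by_cases h : ξ = loser ε s.comb
      · subst h; simp [WalkState.step, wtStep, add_mul]
      · simp [WalkState.step, wtStep, h]
    simp only [e1, e2, Finset.sum_add_distrib, Finset.sum_ite_eq', Finset.mem_univ, if_true]

/-- Induction along the tree: the images of the hitting sets of the two successors keep their volume
and are disjoint, since they lie where opposite last letters are the longer ones. -/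
theorem Reach.volume_le {R : Set (CombData A)} (hR : IsInvariantClass R)
    {G S : Set (WalkState A)} {ρ : ℝ} {s : WalkState A} (h : Reach G S ρ s)
    (hs : s ∈ goodStates R) :
    ENNReal.ofReal ρ * volume (weightSimplex s.wt) ≤
      volume (weightSimplex s.wt ∩ {x | Hits G s x}) := by
  induction h with
  | @goal ρ s hsG hρ =>
    have : {x | Hits G s x} = Set.univ := Set.eq_univ_of_forall fun x => .here hsG
    rw [this, Set.inter_univ]
    exact mul_le_of_le_one_left zero_le (ENNReal.ofReal_le_one.mpr hρ)
  | @fail ρ s hsS hρ => simp [ENNReal.ofReal_of_nonpos hρ]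
  | @step ρ s r h hρ ih =>
    have hirr := hR.irreducible _ hs.1
    set E := weightSimplex s.wt ∩ {x | Hits G s x}
    set H : ArrowType → Set (A → ℝ) := fun ε => {x | x (loser ε s.comb) < x (winner ε s.comb)}
    have hstep : ∀ ε, ENNReal.ofReal (s.prob ε * r ε) * volume (weightSimplex s.wt) ≤
        volume (E ∩ H ε) := by
      intro ε
      refine le_trans ?_ (measure_mono (Set.image_subset_iff.mpr fun x hx =>
        lamBack_mem (G := G) (ε := ε) hirr hx))
      rw [volume_image_lamBack hirr]
      refine le_trans (le_of_eq ?_) (ih ε (s.step_mem_goodStates hR hs ε))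
      rw [volume_weightSimplex_step hs.2, ENNReal.ofReal_mul (s.prob_nonneg hs.2 ε)]
      ring
    have hH : MeasurableSet (H .top) :=
      measurableSet_lt (measurable_pi_apply _) (measurable_pi_apply _)
    have hsub : E ∩ H .bottom ⊆ E \ H .top := fun x hx => ⟨hx.1, fun h' =>
      lt_asymm (show x s.comb.botLast < x s.comb.topLast from h') hx.2⟩
    calc ENNReal.ofReal ρ * volume (weightSimplex s.wt)
        ≤ (ENNReal.ofReal (s.prob .top * r .top) + ENNReal.ofReal (s.prob .bottom * r .bottom)) *
            volume (weightSimplex s.wt) := by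
          gcongr
          exact (ENNReal.ofReal_le_ofReal hρ).trans ENNReal.ofReal_add_le
      _ ≤ volume (E ∩ H .top) + volume (E \ H .top) := by
          rw [add_mul]
          exact add_le_add (hstep _) ((hstep _).trans (measure_mono hsub))
      _ = volume E := measure_inter_add_sdiff E hH

end

/-! ### Lebesgue measure on the affine hyperplane compared with volumes of cones -/

section Hyperplane

variable (A : Type*) [Fintype A]

/-- A vector of sum `t` is its projection to the hyperplane of sum zero plus `t` times the
barycentre. -/
def sumZeroProdEquiv [Nonempty A] : (ℝ × sumZero A) ≃ₗ[ℝ] (A → ℝ) where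
  toFun p ξ := (p.2 : EuclideanSpace ℝ A) ξ + p.1 * (Fintype.card A : ℝ)⁻¹
  map_add' p q := by
    funext ξ
    simp only [Prod.fst_add, Prod.snd_add, Submodule.coe_add, PiLp.add_apply, Pi.add_apply]
    ring
  map_smul' c p := by
    funext ξ
    simp only [Prod.smul_fst, Prod.smul_snd, Submodule.coe_smul, PiLp.smul_apply, Pi.smul_apply,
      smul_eq_mul, RingHom.id_apply]
    ring
  invFun x := (∑ ξ, x ξ, ⟨WithLp.toLp 2 fun ξ => x ξ - (∑ η, x η) * (Fintype.card A : ℝ)⁻¹, by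
    have h : (Fintype.card A : ℝ) ≠ 0 := Nat.cast_ne_zero.mpr Fintype.card_ne_zero
    change ∑ ξ, (x ξ - (∑ η, x η) * (Fintype.card A : ℝ)⁻¹) = 0
    rw [Finset.sum_sub_distrib, Finset.sum_const, Finset.card_univ, nsmul_eq_mul]
    field_simp
    ring⟩)
  left_inv p := by
    have h : (Fintype.card A : ℝ) ≠ 0 := Nat.cast_ne_zero.mpr Fintype.card_ne_zero
    have hv : ∑ ξ, (p.2 : EuclideanSpace ℝ A) ξ = 0 := p.2.2
    have hs : ∑ ξ, ((p.2 : EuclideanSpace ℝ A) ξ + p.1 * (Fintype.card A : ℝ)⁻¹) = p.1 := by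
      rw [Finset.sum_add_distrib, hv, Finset.sum_const, Finset.card_univ, nsmul_eq_mul]
      field_simp
      ring
    refine Prod.ext hs (Subtype.ext ?_)
    ext ξ
    simp only [hs]
    ring
  right_inv x := by
    funext ξ
    simp

theorem sum_sumZeroProdEquiv [Nonempty A] (p : ℝ × sumZero A) :
    ∑ ξ, sumZeroProdEquiv A p ξ = p.1 :=
  congrArg Prod.fst ((sumZeroProdEquiv A).symm_apply_apply p)

theorem measurable_add_barycentre :
    Measurable fun (v : sumZero A) (ξ : A) =>
      (v : EuclideanSpace ℝ A) ξ + (Fintype.card A : ℝ)⁻¹ := by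
  have : Continuous fun (v : sumZero A) (ξ : A) =>
      (v : EuclideanSpace ℝ A) ξ + (Fintype.card A : ℝ)⁻¹ := by fun_prop
  exact this.measurable

/-- The measure of the base of a cone is bounded by that of the cone. -/
theorem exists_hyperplaneLebesgue_le [Nonempty A] :
    ∃ C : ENNReal, C < ⊤ ∧ ∀ E : Set (A → ℝ), MeasurableSet E → (∀ x ∈ E, ∀ ξ, 0 < x ξ) →
      (∀ x ∈ E, ∀ t : ℝ, 0 < t → t • x ∈ E) →
      hyperplaneLebesgue A E ≤ C * volume (E ∩ {x | ∑ ξ, x ξ < 1}) := by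
  let Φ := (sumZeroProdEquiv A).toContinuousLinearEquiv
  let ν : Measure (A → ℝ) := ((volume : Measure ℝ).prod (volume : Measure (sumZero A))).map Φ
  have hν : ν.IsAddHaarMeasure := Φ.isAddHaarMeasure_map _
  -- The product measure in the coordinates (sum, projection) is a Haar measure, hence a multiple of
  -- the volume; the value of the factor is irrelevant.
  set c := Measure.addHaarScalarFactor ν volume
  have hc : ν = c • volume := Measure.isAddLeftInvariant_eq_smul ν volume
  set n := Module.finrank ℝ (sumZero A)
  refine ⟨ENNReal.ofReal (2 ^ n) * 2 * c, ENNReal.mul_lt_top (ENNReal.mul_lt_top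
    ENNReal.ofReal_lt_top ENNReal.ofNat_lt_top) ENNReal.coe_lt_top, fun E hE hpos hcone => ?_⟩
  set F : Set (sumZero A) := {v | Φ (1, v) ∈ E}
  have hF : hyperplaneLebesgue A E = volume F := by
    rw [hyperplaneLebesgue, Measure.map_apply (measurable_add_barycentre A) hE]
    congr 1
    ext v
    have : Φ (1, v) = fun ξ => (v : EuclideanSpace ℝ A) ξ + (Fintype.card A : ℝ)⁻¹ := by
      funext ξ
      change (v : EuclideanSpace ℝ A) ξ + 1 * (Fintype.card A : ℝ)⁻¹ = _
      rw [one_mul]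
    simp only [F, Set.mem_preimage, Set.mem_ofPred_eq, this]
  have hscale : ∀ t : ℝ, 0 < t → {v | Φ (t, v) ∈ E} = t • F := by
    intro t ht
    ext v
    have h1 : Φ (1, t⁻¹ • v) = t⁻¹ • Φ (t, v) := by
      rw [← map_smul, Prod.smul_mk, smul_eq_mul, inv_mul_cancel₀ ht.ne']
    rw [Set.mem_smul_set_iff_inv_smul_mem₀ ht.ne']
    simp only [F, Set.mem_ofPred_eq, h1]
    refine ⟨fun h => hcone _ h _ (inv_pos.mpr ht), fun h => ?_⟩
    have := hcone _ h t ht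
    rwa [smul_smul, mul_inv_cancel₀ ht.ne', one_smul] at this
  -- The slice of a cone at sum `t` is its base scaled by `t`; restricting to `t > 1 / 2` bounds the
  -- factor `t ^ n` below.
  have hvol : ∀ t ∈ Set.Ioo (1 / 2 : ℝ) 1,
      ENNReal.ofReal (2⁻¹ ^ n) * volume F ≤ volume {v | Φ (t, v) ∈ E} := by
    intro t ht
    rw [hscale t (by linarith [ht.1]), Measure.addHaar_smul_of_nonneg _ (by linarith [ht.1])]
    gcongr
    linarith [ht.1]
  set D : Set (A → ℝ) := E ∩ {x | ∑ ξ, x ξ < 1}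
  have hDm : MeasurableSet D := hE.inter (measurableSet_lt (by fun_prop) measurable_const)
  have hνD : ENNReal.ofReal (2⁻¹ ^ n) * volume F * 2⁻¹ ≤ ν D := by
    have hm : MeasurableSet (Φ ⁻¹' D) := Φ.continuous.measurable hDm
    rw [Measure.map_apply Φ.continuous.measurable hDm, Measure.prod_apply hm]
    calc ENNReal.ofReal (2⁻¹ ^ n) * volume F * 2⁻¹
        = ∫⁻ _ in Set.Ioo (1 / 2 : ℝ) 1, ENNReal.ofReal (2⁻¹ ^ n) * volume F := by
          rw [lintegral_const, Measure.restrict_apply MeasurableSet.univ, Set.univ_inter,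
            Real.volume_Ioo]
          congr 1
          rw [show (1 - 1 / 2 : ℝ) = 2⁻¹ by norm_num, ENNReal.ofReal_inv_of_pos two_pos]
          simp
      _ ≤ ∫⁻ t in Set.Ioo (1 / 2 : ℝ) 1, volume (Prod.mk t ⁻¹' (Φ ⁻¹' D)) := by
          refine setLIntegral_mono' measurableSet_Ioo fun t ht => (hvol t ht).trans ?_
          refine measure_mono fun v hv => ⟨hv, ?_⟩
          change ∑ ξ, sumZeroProdEquiv A (t, v) ξ < 1
          rw [sum_sumZeroProdEquiv]
          exact ht.2
      _ ≤ _ := setLIntegral_le_lintegral _ _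
  rw [hc, Measure.smul_apply, ENNReal.smul_def, smul_eq_mul] at hνD
  have h2 : ENNReal.ofReal (2 ^ n) * 2 * (ENNReal.ofReal (2⁻¹ ^ n) * volume F * 2⁻¹) =
      volume F := by
    have e1 : ENNReal.ofReal (2 ^ n) * ENNReal.ofReal (2⁻¹ ^ n) = 1 := by
      rw [← ENNReal.ofReal_mul (by positivity), ← mul_pow]
      norm_num
    have e2 : (2 : ENNReal) * 2⁻¹ = 1 := ENNReal.mul_inv_cancel two_ne_zero ENNReal.ofNat_ne_top
    calc _ = (ENNReal.ofReal (2 ^ n) * ENNReal.ofReal (2⁻¹ ^ n)) * (2 * 2⁻¹) * volume F := by ring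
      _ = volume F := by rw [e1, e2, one_mul, one_mul]
  rw [hF, ← h2, mul_assoc (_ * 2)]
  exact mul_le_mul' le_rfl hνD

end Hyperplane

section

variable {A : Type*} [Fintype A] [DecidableEq A] [Nontrivial A]

/-! ### Rauzy induction along words -/

/-- The lengths after the steps of the given types. -/
def lamRun : List ArrowType → CombData A → (A → ℝ) → A → ℝ
  | [], _, lam => lam
  | ε :: w, π, lam => lamRun w (rauzyOp ε π) (lamStep ε π lam)

/-- The positive vectors whose successive induction steps have the given types. -/
def wordCone : List ArrowType → CombData A → Set (A → ℝ)
  | [], _ => {lam | ∀ ξ, 0 < lam ξ}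
  | ε :: w, π => {lam | (∀ ξ, 0 < lam ξ) ∧ lam (loser ε π) < lam (winner ε π) ∧
      lamStep ε π lam ∈ wordCone w (rauzyOp ε π)}

theorem pos_of_mem_wordCone {w : List ArrowType} {π : CombData A} {lam : A → ℝ}
    (h : lam ∈ wordCone w π) (ξ : A) : 0 < lam ξ := by
  cases w with
  | nil => exact h ξ
  | cons ε w => exact h.1 ξ

theorem lamStep_pos {ε : ArrowType} {π : CombData A} {lam : A → ℝ} (h : ∀ ξ, 0 < lam ξ)
    (hlt : lam (loser ε π) < lam (winner ε π)) (ξ : A) : 0 < lamStep ε π lam ξ := by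
  by_cases hξ : ξ = winner ε π
  · subst hξ; simpa [lamStep] using hlt
  · simpa [lamStep, hξ] using h ξ

theorem lamStep_smul (ε : ArrowType) (π : CombData A) (t : ℝ) (lam : A → ℝ) :
    lamStep ε π (t • lam) = t • lamStep ε π lam := by
  funext ξ
  by_cases hξ : ξ = winner ε π
  · subst hξ; simp [lamStep, mul_sub]
  · simp [lamStep, hξ]

theorem lamBack_lamStep {ε : ArrowType} {π : CombData A} (h : π.Irreducible) (lam : A → ℝ) :
    lamBack ε π (lamStep ε π lam) = lam := by
  have := (h.winner_ne_loser ε).symm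
  simp [lamStep, lamBack, this]

theorem lamRun_smul (w : List ArrowType) (π : CombData A) (t : ℝ) (lam : A → ℝ) :
    lamRun w π (t • lam) = t • lamRun w π lam := by
  induction w generalizing π lam with
  | nil => rfl
  | cons ε w ih => simp only [lamRun, lamStep_smul, ih]

theorem lamRun_append (u v : List ArrowType) (π : CombData A) (lam : A → ℝ) :
    lamRun (u ++ v) π lam = lamRun v (runComb u π) (lamRun u π lam) := by
  induction u generalizing π lam with
  | nil => rfl
  | cons ε u ih => exact ih _ _

theorem mem_wordCone_append {u v : List ArrowType} {π : CombData A} {lam : A → ℝ} :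
    lam ∈ wordCone (u ++ v) π ↔
      lam ∈ wordCone u π ∧ lamRun u π lam ∈ wordCone v (runComb u π) := by
  induction u generalizing π lam with
  | nil => exact ⟨fun h => ⟨pos_of_mem_wordCone h, h⟩, fun h => h.2⟩
  | cons ε u ih =>
    simp only [List.cons_append, wordCone, Set.mem_ofPred_eq, ih, runComb, lamRun, and_assoc]

theorem smul_mem_wordCone {w : List ArrowType} {π : CombData A} {lam : A → ℝ} {t : ℝ}
    (ht : 0 < t) (h : lam ∈ wordCone w π) : t • lam ∈ wordCone w π := by
  induction w generalizing π lam with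
  | nil => exact fun ξ => mul_pos ht (h ξ)
  | cons ε w ih =>
    refine ⟨fun ξ => mul_pos ht (h.1 ξ), mul_lt_mul_of_pos_left h.2.1 ht, ?_⟩
    rw [lamStep_smul]
    exact ih h.2.2

/-- The lengths determine the type of each induction step. -/
theorem prefix_of_mem_wordCone {u v : List ArrowType} {π : CombData A} {lam : A → ℝ}
    (hu : lam ∈ wordCone u π) (hv : lam ∈ wordCone v π) (h : u.length ≤ v.length) : u <+: v := by
  induction u generalizing v π lam with
  | nil => exact List.nil_prefix
  | cons ε u ih =>
    cases v with
    | nil => simp at h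
    | cons ε' v =>
      obtain rfl : ε = ε' := by
        have h1 := hu.2.1
        have h2 := hv.2.1
        cases ε <;> cases ε' <;> first | rfl | exact absurd h1 (lt_asymm h2)
      exact List.cons_prefix_cons.mpr ⟨rfl, ih hu.2.2 hv.2.2 (by simpa using h)⟩

theorem measurable_lamStep (ε : ArrowType) (π : CombData A) : Measurable (lamStep ε π) := by
  refine measurable_pi_lambda _ fun ξ => ?_
  by_cases hξ : ξ = winner ε π
  · subst hξ
    simp only [lamStep, Function.update_self]
    exact (measurable_pi_apply _).sub (measurable_pi_apply _)
  · simpa [lamStep, hξ] using measurable_pi_apply ξ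

theorem measurable_lamRun (w : List ArrowType) (π : CombData A) : Measurable (lamRun w π) := by
  induction w generalizing π with
  | nil => exact measurable_id
  | cons ε w ih => exact (ih _).comp (measurable_lamStep ε π)

theorem measurableSet_pos : MeasurableSet {lam : A → ℝ | ∀ ξ, 0 < lam ξ} := by
  simp only [Set.ofPred_forall]
  exact MeasurableSet.iInter fun ξ => measurableSet_lt measurable_const (measurable_pi_apply ξ)

theorem measurableSet_wordCone (w : List ArrowType) (π : CombData A) :
    MeasurableSet (wordCone w π) := by
  induction w generalizing π with
  | nil => exact measurableSet_pos
  | cons ε w ih =>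
    have h : MeasurableSet {lam : A → ℝ | lam (loser ε π) < lam (winner ε π)} :=
      measurableSet_lt (measurable_pi_apply _) (measurable_pi_apply _)
    exact measurableSet_pos.inter (h.inter (measurable_lamStep ε π (ih _)))

theorem sum_lamStep (ε : ArrowType) (π : CombData A) (lam : A → ℝ) :
    ∑ ξ, lamStep ε π lam ξ = ∑ ξ, lam ξ - lam (loser ε π) := by
  rw [← Finset.add_sum_erase _ _ (Finset.mem_univ (winner ε π)),
    ← Finset.add_sum_erase Finset.univ lam (Finset.mem_univ (winner ε π))]
  have : ∑ ξ ∈ Finset.univ.erase (winner ε π), lamStep ε π lam ξ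
      = ∑ ξ ∈ Finset.univ.erase (winner ε π), lam ξ :=
    Finset.sum_congr rfl fun ξ hξ => by simp [lamStep, Finset.ne_of_mem_erase hξ]
  rw [this]
  simp [lamStep]

theorem sum_lamRun_le {w : List ArrowType} {π : CombData A} {lam : A → ℝ}
    (h : lam ∈ wordCone w π) : ∑ ξ, lamRun w π lam ξ ≤ ∑ ξ, lam ξ := by
  induction w generalizing π lam with
  | nil => exact le_rfl
  | cons ε w ih =>
    refine (ih h.2.2).trans ?_
    rw [sum_lamStep]
    linarith [h.1 (loser ε π)]

theorem sum_lamRun_lt {w : List ArrowType} {π : CombData A} {lam : A → ℝ}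
    (h : lam ∈ wordCone w π) (hw : w ≠ []) : ∑ ξ, lamRun w π lam ξ < ∑ ξ, lam ξ := by
  cases w with
  | nil => exact absurd rfl hw
  | cons ε w =>
    refine (sum_lamRun_le h.2.2).trans_lt ?_
    rw [sum_lamStep]
    linarith [h.1 (loser ε π)]

theorem lamRun_pos {w : List ArrowType} {π : CombData A} {lam : A → ℝ}
    (h : lam ∈ wordCone w π) (ξ : A) : 0 < lamRun w π lam ξ := by
  rw [← List.append_nil w] at h
  exact (mem_wordCone_append.mp h).2 ξ

/-- Weights move by `B` and lengths by `(B^*)⁻¹`. This invariance is what converts a bound on the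
weights into a lower bound on the remaining length. -/
theorem sum_wt_mul_lamStep {s : WalkState A} (hs : s.comb.Irreducible) (ε : ArrowType)
    (lam : A → ℝ) : ∑ ξ, (s.step ε).wt ξ * lamStep ε s.comb lam ξ = ∑ ξ, s.wt ξ * lam ξ := by
  have hne := hs.winner_ne_loser ε
  have e1 : ∀ ξ, (s.step ε).wt ξ * lamStep ε s.comb lam ξ = s.wt ξ * lam ξ +
      ((if ξ = loser ε s.comb then s.wt (winner ε s.comb) * lam (loser ε s.comb) else 0) -
      if ξ = winner ε s.comb then s.wt (winner ε s.comb) * lam (loser ε s.comb) else 0) := by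
    intro ξ
    by_cases h : ξ = winner ε s.comb
    · subst h; simp [WalkState.step, wtStep, lamStep, mul_sub, hne]
      ring
    · by_cases h' : ξ = loser ε s.comb
      · subst h'; simp [WalkState.step, wtStep, lamStep, add_mul, h]
      · simp [WalkState.step, wtStep, lamStep, h, h']
  simp only [e1, Finset.sum_add_distrib, Finset.sum_sub_distrib, Finset.sum_ite_eq',
    Finset.mem_univ, if_true]
  ring

theorem sum_wt_mul_lamRun {R : Set (CombData A)} (hR : IsInvariantClass R) (w : List ArrowType)
    {s : WalkState A} (hs : s ∈ goodStates R) (lam : A → ℝ) :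
    ∑ ξ, (s.run w).wt ξ * lamRun w s.comb lam ξ = ∑ ξ, s.wt ξ * lam ξ := by
  induction w generalizing s lam with
  | nil => rfl
  | cons ε w ih =>
    exact (ih (s.step_mem_goodStates hR hs ε) _).trans
      (sum_wt_mul_lamStep (hR.irreducible _ hs.1) ε lam)

theorem hits_iff {G : Set (WalkState A)} {s : WalkState A} {lam : A → ℝ} (hlam : ∀ ξ, 0 < lam ξ) :
    Hits G s lam ↔ ∃ w, lam ∈ wordCone w s.comb ∧ s.run w ∈ G := by
  constructor
  · intro h
    induction h with
    | here hs => exact ⟨[], hlam, hs⟩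
    | next ε h _ ih =>
      obtain ⟨w, h1, h2⟩ := ih (lamStep_pos hlam h)
      exact ⟨ε :: w, ⟨hlam, h, h1⟩, h2⟩
  · rintro ⟨w, h1, h2⟩
    induction w generalizing s lam with
    | nil => exact .here h2
    | cons ε w ih =>
      exact .next ε h1.2.1 (ih (pos_of_mem_wordCone h1.2.2) h1.2.2 h2)

/-! ### Relation with the induction map and with paths -/

theorem rauzyQ_of_lt {ε : ArrowType} {π : CombData A} {lam : A → ℝ}
    (h : lam (loser ε π) < lam (winner ε π)) :
    inductionType lam π = ε ∧ rauzyQ (lam, π) = (lamStep ε π lam, rauzyOp ε π) := by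
  have hε : inductionType lam π = ε := by
    cases ε
    · exact if_pos h
    · exact if_neg (lt_asymm h)
  refine ⟨hε, ?_⟩
  simp only [rauzyQ, hε, Prod.mk.injEq, and_true, inductionLengths, lamStep]
  congr 1
  cases ε
  · exact abs_of_pos (sub_pos.mpr h)
  · rw [abs_sub_comm]; exact abs_of_pos (sub_pos.mpr h)

theorem iterate_rauzyQ {w : List ArrowType} {π : CombData A} {lam : A → ℝ}
    (h : lam ∈ wordCone w π) :
    rauzyQ^[w.length] (lam, π) = (lamRun w π lam, runComb w π) := by
  induction w generalizing π lam with
  | nil => rfl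
  | cons ε w ih =>
    rw [List.length_cons, Function.iterate_succ_apply, (rauzyQ_of_lt h.2.1).2, ih h.2.2]
    rfl

variable {R : Set (CombData A)}

omit [Fintype A] [DecidableEq A] [Nontrivial A] in
theorem Vertex.ext' [Fintype A] {R : Set (CombData A)} {a b : Vertex R} (h : a.val = b.val) :
    a = b := by
  cases a; cases b; simp_all

/-- The list of arrow types of a path. -/
def pathTypes : {a b : Vertex R} → Quiver.Path a b → List ArrowType
  | _, _, .nil => []
  | _, _, .cons γ e => pathTypes γ ++ [e.1]

omit [DecidableEq A] in
theorem runComb_pathTypes {a b : Vertex R} (γ : Quiver.Path a b) :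
    runComb (pathTypes γ) a.val = b.val := by
  induction γ with
  | nil => rw [pathTypes, runComb]
  | cons γ e ih => rw [pathTypes, runComb_append, ih]; exact e.2

omit [DecidableEq A] in
theorem length_pathTypes {a b : Vertex R} (γ : Quiver.Path a b) :
    (pathTypes γ).length = γ.length := by
  induction γ with
  | nil => rw [pathTypes]; rfl
  | cons γ e ih => simp [pathTypes, ih]

omit [DecidableEq A] in
theorem pathTypes_comp {a b c : Vertex R} (γ : Quiver.Path a b) (δ : Quiver.Path b c) :
    pathTypes (γ.comp δ) = pathTypes γ ++ pathTypes δ := by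
  induction δ with
  | nil => simp [pathTypes]
  | cons δ e ih => simp [pathTypes, ih]

omit [DecidableEq A] in
theorem pathTypes_injective {a b : Vertex R} {γ δ : Quiver.Path a b}
    (h : pathTypes γ = pathTypes δ) : γ = δ := by
  induction γ with
  | nil =>
    cases δ with
    | nil => rfl
    | cons δ e => simp [pathTypes] at h
  | @cons ρ b γ e ih =>
    cases δ with
    | nil => simp [pathTypes] at h
    | @cons ρ' _ δ e' =>
      rw [pathTypes, pathTypes] at h
      obtain ⟨h1, h2⟩ := List.append_inj' h rfl
      obtain rfl : ρ = ρ' := Vertex.ext' (by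
        rw [← runComb_pathTypes γ, ← runComb_pathTypes δ, h1])
      obtain rfl := ih h1
      obtain rfl : e = e' := Subtype.ext (by simpa using h2)
      rfl

omit [DecidableEq A] in
theorem exists_path (hR : IsInvariantClass R) (w : List ArrowType) {a b : Vertex R}
    (h : runComb w a.val = b.val) : ∃ γ : Quiver.Path a b, pathTypes γ = w := by
  induction w using List.reverseRecOn generalizing b with
  | nil =>
    obtain rfl : a = b := Vertex.ext' h
    exact ⟨.nil, by rw [pathTypes]⟩
  | append_singleton w ε ih =>
    rw [runComb_append] at h
    obtain ⟨γ, hγ⟩ := ih (b := ⟨runComb w a.val, hR.runComb_mem w a.mem⟩) rfl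
    exact ⟨.cons γ ⟨ε, h⟩, by rw [pathTypes, hγ]⟩

theorem mem_pathCone {a b : Vertex R} (γ : Quiver.Path a b) (x : (A → ℝ) × CombData A) :
    x ∈ pathCone γ ↔ x.2 = a.val ∧ x.1 ∈ wordCone (pathTypes γ) a.val := by
  induction γ with
  | nil => rw [pathCone, pathTypes]; exact and_comm
  | @cons ρ b γ e ih =>
    rw [pathCone, Set.mem_ofPred_eq, pathTypes, mem_wordCone_append, ← and_assoc, ← ih]
    refine and_congr_right fun hx => ?_
    obtain ⟨h1, h2⟩ := ih.mp hx
    have hit := iterate_rauzyQ h2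
    rw [length_pathTypes, runComb_pathTypes, ← h1] at hit
    rw [show x = (x.1, x.2) from rfl, hit, runComb_pathTypes]
    constructor
    · intro h
      rw [h1] at h
      exact ⟨h.1.1, h.2, lamStep_pos h.1.1 h.2⟩
    · intro h
      rw [h1]
      exact ⟨⟨h.1, rfl⟩, h.2.1⟩

/-- The word of a neat loop has no proper non-trivial prefix that is a suffix and a loop. -/
theorem Neat.eq_or_eq_nil (hR : IsInvariantClass R) {π : Vertex R} {γ : Quiver.Path π π}
    (hγ : Neat γ) {s d e : List ArrowType} (h1 : pathTypes γ = s ++ d)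
    (h2 : pathTypes γ = d ++ e) (hs : runComb s π.val = π.val) : d = pathTypes γ ∨ d = [] := by
  have h3 := runComb_pathTypes γ
  have hd : runComb d π.val = π.val := by rwa [h1, runComb_append, hs] at h3
  have he : runComb e π.val = π.val := by rwa [h2, runComb_append, hd] at h3
  obtain ⟨γs, hγs⟩ := exists_path hR s hs
  obtain ⟨δ, hδ⟩ := exists_path hR d hd
  obtain ⟨γe, hγe⟩ := exists_path hR e he
  rcases hγ.2 δ γs γe (pathTypes_injective (by rw [pathTypes_comp, hγs, hδ, h1]))
    (pathTypes_injective (by rw [pathTypes_comp, hγe, hδ, h2])) with h | h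
  · exact .inl (by rw [← hδ, h])
  · exact .inr (by rw [← hδ, h, pathTypes])

theorem arrowMatrix_transpose (ε : ArrowType) (π : CombData A) :
    (arrowMatrix ε π)ᵀ = transvection (winner ε π) (loser ε π) 1 := by
  simp [arrowMatrix, transvection]

theorem arrowMatrix_transpose_mulVec (ε : ArrowType) (π : CombData A) (x : A → ℝ) :
    (arrowMatrix ε π)ᵀ *ᵥ x = lamBack ε π x := by
  rw [arrowMatrix_transpose, lamBack_eq, Matrix.toLin'_apply]

theorem arrowMatrix_transpose_inv_mulVec {ε : ArrowType} {π : CombData A} (h : π.Irreducible)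
    (x : A → ℝ) : ((arrowMatrix ε π)ᵀ)⁻¹ *ᵥ x = lamStep ε π x := by
  have hdet : IsUnit ((arrowMatrix ε π)ᵀ).det := by
    rw [arrowMatrix_transpose, det_transvection_of_ne _ _ (h.winner_ne_loser ε)]
    exact isUnit_one
  have : x = (arrowMatrix ε π)ᵀ *ᵥ lamStep ε π x := by
    rw [arrowMatrix_transpose_mulVec, lamBack_lamStep h]
  conv_lhs => rw [this]
  rw [mulVec_mulVec, nonsing_inv_mul _ hdet, one_mulVec]

theorem pathMatrix_transpose_mulVec_lamRun (hR : IsInvariantClass R) {a b : Vertex R}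
    (γ : Quiver.Path a b) (x : A → ℝ) :
    (pathMatrix γ)ᵀ *ᵥ lamRun (pathTypes γ) a.val x = x := by
  induction γ with
  | nil => simp [pathMatrix, pathTypes, lamRun]
  | @cons ρ b γ e ih =>
    rw [pathMatrix, transpose_mul, ← mulVec_mulVec, pathTypes, lamRun_append,
      runComb_pathTypes, arrowMatrix_transpose_mulVec]
    simp only [lamRun]
    rw [lamBack_lamStep (hR.irreducible _ ρ.mem), ih]

theorem lamRun_pathMatrix_transpose_mulVec (hR : IsInvariantClass R) {a b : Vertex R}
    (γ : Quiver.Path a b) (x : A → ℝ) :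
    lamRun (pathTypes γ) a.val ((pathMatrix γ)ᵀ *ᵥ x) = x := by
  induction γ generalizing x with
  | nil => simp [pathMatrix, pathTypes, lamRun]
  | @cons ρ b γ e ih =>
    rw [pathMatrix, transpose_mul, ← mulVec_mulVec, pathTypes, lamRun_append,
      runComb_pathTypes, arrowMatrix_transpose_mulVec, ih]
    exact lamStep_lamBack (hR.irreducible _ ρ.mem) x

theorem mem_pathSuspCone (hR : IsInvariantClass R) {a b : Vertex R} (γ : Quiver.Path a b)
    (τ : A → ℝ) :
    τ ∈ pathSuspCone γ ↔ ∃ σ ∈ suspCone a.val, lamRun (pathTypes γ) a.val σ = τ := by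
  constructor
  · exact fun h => ⟨_, h, lamRun_pathMatrix_transpose_mulVec hR γ τ⟩
  · rintro ⟨σ, hσ, rfl⟩
    rw [pathSuspCone, Set.mem_ofPred_eq, pathMatrix_transpose_mulVec_lamRun hR]
    exact hσ

theorem pathMatrix_mulVec_single {a b : Vertex R} (γ : Quiver.Path a b) {η : A}
    (h : ∀ w ε, winner ε (runComb w a.val) ≠ η) :
    pathMatrix γ *ᵥ Pi.single η 1 = Pi.single η 1 := by
  induction γ with
  | nil => rw [pathMatrix, one_mulVec]
  | @cons ρ b γ e ih =>
    have hne : winner e.1 ρ.val ≠ η := by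
      have := h (pathTypes γ) e.1
      rwa [runComb_pathTypes] at this
    rw [pathMatrix, ← mulVec_mulVec, ih, arrowMatrix, add_mulVec, one_mulVec,
      Matrix.single_mulVec]
    simp [hne]

/-- If `η` never won, the column of `B_γ` at `η` would be the unit vector, which has a zero entry
because there are at least two letters. -/
theorem StronglyPositive.exists_winner {π : Vertex R} {γ : Quiver.Path π π}
    (hγ : StronglyPositive γ) (η : A) : ∃ w ε, winner ε (runComb w π.val) = η := by
  by_contra! h
  obtain ⟨ξ, hξ⟩ := exists_ne η
  have h1 := congrFun (pathMatrix_mulVec_single γ h) ξ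
  rw [mulVec_single_one, Pi.single_eq_of_ne hξ] at h1
  exact (hγ.1 ξ η).ne' h1

theorem StronglyPositive.pathTypes_ne_nil {π : Vertex R} {γ : Quiver.Path π π}
    (hγ : StronglyPositive γ) : pathTypes γ ≠ [] := by
  cases γ with
  | nil =>
    obtain ⟨ξ, η, hξ⟩ := exists_pair_ne A
    have h1 := hγ.1 ξ η
    rw [pathMatrix, one_apply_ne hξ] at h1
    exact absurd h1 (lt_irrefl _)
  | cons γ e => simp [pathTypes]

end

/-! ### Partial sums along a row -/

section RowSums

variable {A : Type*} [Fintype A] {n : ℕ}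

/-- The sum of a vector over the first `k` letters of a row. -/
def rowSum (r : A ≃ Fin n) (τ : A → ℝ) (k : ℕ) : ℝ := ∑ ξ with (r ξ : ℕ) < k, τ ξ

theorem rowSum_succ (r : A ≃ Fin n) (τ : A → ℝ) (x : A) :
    rowSum r τ (r x + 1) = rowSum r τ (r x) + τ x := by
  classical
  have : ({ξ | (r ξ : ℕ) < r x + 1} : Finset A) = insert x ({ξ | (r ξ : ℕ) < r x} : Finset A) := by
    ext ξ
    simp only [Finset.mem_filter, Finset.mem_univ, true_and, Finset.mem_insert]
    refine ⟨fun h => ?_, ?_⟩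
    · rcases Nat.lt_succ_iff_lt_or_eq.mp h with h | h
      exacts [.inr h, .inl (row_ext r h)]
    · rintro (rfl | h) <;> omega
  rw [rowSum, this, Finset.sum_insert (by simp), add_comm]
  rfl

theorem rowSum_zero (r : A ≃ Fin n) (τ : A → ℝ) : rowSum r τ 0 = 0 := by simp [rowSum]

theorem rowSum_last (r : A ≃ Fin n) (τ : A → ℝ) : rowSum r τ n = ∑ ξ, τ ξ := by simp [rowSum]

theorem rowSum_neg (r : A ≃ Fin n) (τ : A → ℝ) (k : ℕ) : rowSum r (-τ) k = -rowSum r τ k := by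
  simp [rowSum]

theorem rowSum_update [DecidableEq A] (r : A ≃ Fin n) (τ : A → ℝ) (a : A) (c : ℝ) (k : ℕ) :
    rowSum r (Function.update τ a (τ a - c)) k = rowSum r τ k - if (r a : ℕ) < k then c else 0 := by
  have : ∀ ξ, Function.update τ a (τ a - c) ξ = τ ξ - if ξ = a then c else 0 := by
    intro ξ
    by_cases h : ξ = a
    · subst h; simp
    · simp [h]
  simp only [rowSum, this, Finset.sum_sub_distrib, Finset.sum_ite_eq', Finset.mem_filter,
    Finset.mem_univ, true_and]

theorem rowSum_moveRow_of_le (r : A ≃ Fin n) (τ : A → ℝ) (b : A) {k : ℕ} (hk : k ≤ r b + 1) :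
    rowSum (moveRow r b) τ k = rowSum r τ k := by
  have : ∀ ξ, ((moveRow r b ξ : ℕ) < k ↔ (r ξ : ℕ) < k) := fun ξ => by
    have := moveRow_val r b ξ
    have := (r ξ).2
    omega
  simp only [rowSum, this]

theorem rowSum_moveRow_of_lt (r : A ≃ Fin n) (τ : A → ℝ) {a b : A} (ha : (r a : ℕ) + 1 = n)
    (hab : b ≠ a) {k : ℕ} (hk : r b + 1 ≤ k) (hkn : k < n) :
    rowSum (moveRow r b) τ (k + 1) = rowSum r τ k + τ a := by
  classical
  have hne : (r b : ℕ) ≠ r a := fun h => hab (row_ext r h)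
  have : ({ξ | (moveRow r b ξ : ℕ) < k + 1} : Finset A) =
      insert a ({ξ | (r ξ : ℕ) < k} : Finset A) := by
    ext ξ
    simp only [Finset.mem_filter, Finset.mem_univ, true_and, Finset.mem_insert]
    have h1 := moveRow_val r b ξ
    have h2 := (r ξ).2
    have h3 := (r b).2
    by_cases h : ξ = a
    · subst h
      simp only [true_or, iff_true]
      omega
    · have h' : (r ξ : ℕ) ≠ r a := fun h' => h (row_ext r h')
      simp only [h, false_or]
      omega
  rw [rowSum, this, Finset.sum_insert (by simp; omega), add_comm]
  rfl

end RowSums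

variable {A : Type*} [Fintype A] [DecidableEq A] [Nontrivial A]

/-! ### Suspension data -/

theorem mem_suspCone {π : CombData A} {τ : A → ℝ} :
    τ ∈ suspCone π ↔ ∀ k : ℕ, 1 ≤ k → k ≤ Fintype.card A - 1 →
      0 < rowSum π.top τ k ∧ rowSum π.bot τ k < 0 := Iff.rfl

theorem neg_mem_suspCone_swap {π : CombData A} {τ : A → ℝ} :
    -τ ∈ suspCone π.swap ↔ τ ∈ suspCone π := by
  simp only [mem_suspCone, CombData.swap, rowSum_neg, Left.neg_pos_iff, Left.neg_neg_iff]
  exact forall_congr' fun k => forall_congr' fun _ => forall_congr' fun _ => and_comm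

theorem lamStep_neg (ε : ArrowType) (π : CombData A) (τ : A → ℝ) :
    lamStep ε π (-τ) = -lamStep ε π τ := by
  have := lamStep_smul ε π (-1) τ
  simpa using this

theorem lamStep_swap (ε : ArrowType) (π : CombData A) (τ : A → ℝ) :
    lamStep ε π.swap τ = lamStep ε.flip π τ := by
  simp only [lamStep, winner_swap, loser_swap]

theorem smul_mem_suspCone {π : CombData A} {τ : A → ℝ} {t : ℝ} (ht : 0 < t)
    (h : τ ∈ suspCone π) : t • τ ∈ suspCone π := by
  intro k h1 h2
  obtain ⟨h3, h4⟩ := h k h1 h2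
  simp only [Pi.smul_apply, smul_eq_mul, ← Finset.mul_sum]
  exact ⟨mul_pos ht h3, mul_neg_of_pos_of_neg ht h4⟩

theorem rowSum_top_topLast (π : CombData A) (τ : A → ℝ) :
    rowSum π.top τ (Fintype.card A - 1) = ∑ ξ, τ ξ - τ π.topLast := by
  have h := rowSum_succ π.top τ π.topLast
  have h2 := top_topLast π
  rw [h2, rowSum_last] at h
  rw [show Fintype.card A - 1 = π.top π.topLast by omega]
  linarith

theorem rowSum_bot_botLast (π : CombData A) (τ : A → ℝ) :
    rowSum π.bot τ (Fintype.card A - 1) = ∑ ξ, τ ξ - τ π.botLast :=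
  rowSum_top_topLast π.swap τ

/-- The new total is the old sum over all letters of the bottom row but the last. After a bottom
arrow the total is positive, so its sign reveals the type of the last arrow. -/
theorem sum_lamStep_top_neg {π : CombData A} {τ : A → ℝ} (h : τ ∈ suspCone π) :
    ∑ ξ, lamStep .top π τ ξ < 0 := by
  have hd : 1 < Fintype.card A := Fintype.one_lt_card
  rw [sum_lamStep]
  have := (mem_suspCone.mp h (Fintype.card A - 1) (by omega) le_rfl).2
  rwa [rowSum_bot_botLast] at this

theorem sum_lamStep_bottom_pos {π : CombData A} {τ : A → ℝ} (h : τ ∈ suspCone π) :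
    0 < ∑ ξ, lamStep .bottom π τ ξ := by
  have := sum_lamStep_top_neg (neg_mem_suspCone_swap.mpr h)
  rw [lamStep_neg, lamStep_swap] at this
  simpa [ArrowType.flip] using this

/-- The proper top sums do not involve the winner. The bottom sums are unchanged before the winner
and shift by one place after the loser; the only new one, ending at the winner, is a non-positive
old sum plus `τ_α - τ_β`, which is negative because the total minus `τ_α` is positive and the total
minus `τ_β` is negative. -/
theorem lamStep_top_mem_suspCone {π : CombData A} (hne : π.topLast ≠ π.botLast) {τ : A → ℝ}
    (h : τ ∈ suspCone π) : lamStep .top π τ ∈ suspCone (rauzyOp .top π) := by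
  rw [mem_suspCone] at h
  have hd : 1 < Fintype.card A := Fintype.one_lt_card
  obtain ⟨h1, h2⟩ := h (Fintype.card A - 1) (by omega) le_rfl
  rw [rowSum_top_topLast] at h1
  rw [rowSum_bot_botLast] at h2
  have hb := bot_botLast π
  have hm : (π.bot π.topLast : ℕ) ≠ π.bot π.botLast := fun h => hne (row_ext _ h)
  have hm' := (π.bot π.topLast).2
  intro k hk hk'
  change 0 < rowSum π.top (Function.update τ π.topLast (τ π.topLast - τ π.botLast)) k ∧
    rowSum (moveRow π.bot π.topLast)
      (Function.update τ π.topLast (τ π.topLast - τ π.botLast)) k < 0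
  rw [rowSum_update, rowSum_update]
  have ht := top_topLast π
  rw [if_neg (by omega), sub_zero]
  refine ⟨(h k hk hk').1, ?_⟩
  have hv := moveRow_val π.bot π.topLast π.topLast
  rcases lt_trichotomy k (π.bot π.topLast + 1) with hlt | rfl | hgt
  · rw [rowSum_moveRow_of_le _ _ _ hlt.le, if_neg (by omega), sub_zero]
    exact (h k hk hk').2
  · rw [rowSum_moveRow_of_le _ _ _ le_rfl, if_pos (by omega), rowSum_succ]
    have h3 : rowSum π.bot τ (π.bot π.topLast) ≤ 0 := by
      rcases Nat.eq_zero_or_pos (π.bot π.topLast : ℕ) with h0 | h0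
      · rw [h0, rowSum_zero]
      · exact (h _ h0 (by omega)).2.le
    linarith
  · obtain ⟨j, rfl⟩ : ∃ j, k = j + 1 := ⟨k - 1, by omega⟩
    rw [rowSum_moveRow_of_lt _ _ hb hne (by omega) (by omega), if_pos (by omega)]
    have := (h j (by omega) (by omega)).2
    linarith

theorem lamStep_mem_suspCone {π : CombData A} (hπ : π.Irreducible) {τ : A → ℝ}
    (h : τ ∈ suspCone π) (ε : ArrowType) : lamStep ε π τ ∈ suspCone (rauzyOp ε π) := by
  cases ε
  · exact lamStep_top_mem_suspCone hπ.topLast_ne_botLast h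
  · have := lamStep_top_mem_suspCone (π := π.swap) hπ.topLast_ne_botLast.symm
      (neg_mem_suspCone_swap.mpr h)
    rwa [rauzyOp_swap, lamStep_neg, lamStep_swap, neg_mem_suspCone_swap] at this

theorem lamRun_mem_suspCone {R : Set (CombData A)} (hR : IsInvariantClass R)
    (w : List ArrowType) {π : CombData A} (hπ : π ∈ R) {τ : A → ℝ} (h : τ ∈ suspCone π) :
    lamRun w π τ ∈ suspCone (runComb w π) := by
  induction w generalizing π τ with
  | nil => exact h
  | cons ε w ih =>
    exact ih (hR.rauzyOp_mem π hπ ε) (lamStep_mem_suspCone (hR.irreducible π hπ) h ε)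

/-- The suspension datum determines the last arrows that led to it. -/
theorem suffix_of_lamRun_eq {R : Set (CombData A)} (hR : IsInvariantClass R)
    {u v : List ArrowType} {π ρ : CombData A} (hπ : π ∈ R) (hρ : ρ ∈ R) {σ τ : A → ℝ}
    (hσ : σ ∈ suspCone π) (hτ : τ ∈ suspCone ρ) (hend : runComb u π = runComb v ρ)
    (h : lamRun u π σ = lamRun v ρ τ) (hlen : v.length ≤ u.length) : v <:+ u := by
  induction v using List.reverseRecOn generalizing u with
  | nil => exact List.nil_suffix
  | append_singleton v ε ih =>
    induction u using List.reverseRecOn with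
    | nil => simp at hlen
    | append_singleton u ε' _ =>
      have h1 := lamRun_mem_suspCone hR u hπ hσ
      have h2 := lamRun_mem_suspCone hR v hρ hτ
      rw [lamRun_append, lamRun_append] at h
      have hsum := congrArg (fun x : A → ℝ => ∑ ξ, x ξ) h
      simp only [lamRun] at hsum h
      obtain rfl : ε' = ε := by
        have a1 := sum_lamStep_top_neg h1
        have a2 := sum_lamStep_top_neg h2
        have b1 := sum_lamStep_bottom_pos h1
        have b2 := sum_lamStep_bottom_pos h2
        cases ε <;> cases ε' <;> first | rfl | (exfalso; linarith)
      rw [runComb_append, runComb_append] at hend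
      have hend' := rauzyOp_injective ε' hend
      rw [hend'] at h
      have hirr := hR.irreducible _ (hR.runComb_mem v hρ)
      have h' := Function.LeftInverse.injective (lamBack_lamStep (ε := ε') hirr) h
      obtain ⟨p, hp⟩ := ih hend' h' (by simpa using hlen)
      exact ⟨p, by rw [← hp, List.append_assoc]⟩

/-! ### The area -/

/-- The heights of the zippered rectangles. -/
def height (π : CombData A) (τ : A → ℝ) (y : A) : ℝ :=
  rowSum π.top τ (π.top y) - rowSum π.bot τ (π.bot y)

omit [DecidableEq A] [Nontrivial A] in
theorem area_eq (x : Zippered A) : area x = ∑ y, x.lam y * height x.comb x.tau y := by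
  rw [area, dotProduct, ← Finset.sum_neg_distrib]
  refine Finset.sum_congr rfl fun y _ => ?_
  rw [← mul_neg]
  congr 1
  rw [mulVec, dotProduct, height, rowSum, rowSum, Finset.sum_filter, Finset.sum_filter,
    ← Finset.sum_sub_distrib, ← Finset.sum_neg_distrib]
  refine Finset.sum_congr rfl fun z _ => ?_
  simp only [omega, of_apply, Fin.lt_def]
  by_cases hzy : z = y
  · subst hzy; simp
  have h1 : (x.comb.top z : ℕ) ≠ x.comb.top y := fun h => hzy (row_ext _ h)
  have h2 : (x.comb.bot z : ℕ) ≠ x.comb.bot y := fun h => hzy (row_ext _ h)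
  rcases lt_or_gt_of_ne h1 with a | a <;> rcases lt_or_gt_of_ne h2 with b | b <;>
    simp [a, b, a.not_gt, b.not_gt]

omit [Nontrivial A] [DecidableEq A] in
theorem height_swap (π : CombData A) (τ : A → ℝ) (y : A) :
    height π.swap (-τ) y = height π τ y := by
  simp only [height, CombData.swap, rowSum_neg]
  ring

/-- Cutting and stacking: the length of `α` loses that of `β`, while the height of `β` gains that of
`α`, so the changes cancel. -/
theorem sum_height_lamStep_top {π : CombData A} (hne : π.topLast ≠ π.botLast)
    (lam τ : A → ℝ) :
    ∑ y, lamStep .top π lam y * height (rauzyOp .top π) (lamStep .top π τ) y =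
      ∑ y, lam y * height π τ y := by
  have hb := bot_botLast π
  have ht := top_topLast π
  have hm : (π.bot π.topLast : ℕ) ≠ π.bot π.botLast := fun h => hne (row_ext _ h)
  have hm' := (π.bot π.topLast).2
  have hbb : rowSum π.bot τ (π.bot π.botLast) = ∑ ξ, τ ξ - τ π.botLast := by
    rw [← rowSum_bot_botLast, show Fintype.card A - 1 = π.bot π.botLast by omega]
  have htt : rowSum π.top τ (π.top π.topLast) = ∑ ξ, τ ξ - τ π.topLast := by
    rw [← rowSum_top_topLast, show Fintype.card A - 1 = π.top π.topLast by omega]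
  have hheight : ∀ y, height (rauzyOp .top π) (lamStep .top π τ) y = height π τ y +
      if y = π.botLast then height π τ π.topLast else 0 := by
    intro y
    change rowSum π.top (Function.update τ π.topLast (τ π.topLast - τ π.botLast)) (π.top y) -
      rowSum (moveRow π.bot π.topLast)
      (Function.update τ π.topLast (τ π.topLast - τ π.botLast)) (moveRow π.bot π.topLast y) = _
    have hy := (π.top y).2
    have hy' := (π.bot y).2
    have hv := moveRow_val π.bot π.topLast π.topLast
    have hvy := moveRow_val π.bot π.topLast y
    rw [rowSum_update, rowSum_update, if_neg (by omega), sub_zero]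
    by_cases hyb : y = π.botLast
    · subst hyb
      rw [if_pos rfl, show (moveRow π.bot π.topLast π.botLast : ℕ) = π.bot π.topLast + 1 by omega,
        rowSum_moveRow_of_le _ _ _ le_rfl, rowSum_succ, if_pos (by omega), height, height, hbb, htt]
      ring
    · have hyb' : (π.bot y : ℕ) ≠ π.bot π.botLast := fun h => hyb (row_ext _ h)
      rw [if_neg hyb, add_zero, height]
      rcases le_or_gt (π.bot y : ℕ) (π.bot π.topLast) with hle | hgt
      · rw [show (moveRow π.bot π.topLast y : ℕ) = π.bot y by omega,
          rowSum_moveRow_of_le _ _ _ (by omega), if_neg (by omega), sub_zero]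
      · rw [show (moveRow π.bot π.topLast y : ℕ) = π.bot y + 1 by omega,
          rowSum_moveRow_of_lt _ _ hb hne (by omega) (by omega), if_pos (by omega)]
        ring
  have hlam : ∀ y, lamStep .top π lam y = lam y -
      if y = π.topLast then lam π.botLast else 0 := by
    intro y
    by_cases h : y = π.topLast
    · subst h; simp [lamStep, winner, loser]
    · simp [lamStep, winner, h]
  have hterm : ∀ y, lamStep .top π lam y * height (rauzyOp .top π) (lamStep .top π τ) y =
      lam y * height π τ y +
      ((if y = π.botLast then lam π.botLast * height π τ π.topLast else 0) -
        if y = π.topLast then lam π.botLast * height π τ π.topLast else 0) := by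
    intro y
    rw [hheight, hlam]
    by_cases h1 : y = π.topLast
    · subst h1
      simp only [if_true, if_neg hne]
      ring
    · by_cases h2 : y = π.botLast
      · subst h2
        simp only [if_true, if_neg h1]
        ring
      · simp only [if_neg h1, if_neg h2]
        ring
  simp only [hterm, Finset.sum_add_distrib, Finset.sum_sub_distrib, Finset.sum_ite_eq',
    Finset.mem_univ, if_true, sub_self, add_zero]

theorem sum_height_lamStep {π : CombData A} (hπ : π.Irreducible) (ε : ArrowType)
    (lam τ : A → ℝ) :
    ∑ y, lamStep ε π lam y * height (rauzyOp ε π) (lamStep ε π τ) y =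
      ∑ y, lam y * height π τ y := by
  cases ε
  · exact sum_height_lamStep_top hπ.topLast_ne_botLast lam τ
  · have := sum_height_lamStep_top (π := π.swap) hπ.topLast_ne_botLast.symm lam (-τ)
    simpa only [rauzyOp_swap, lamStep_neg, lamStep_swap, height_swap, ArrowType.flip] using this

theorem sum_height_lamRun {R : Set (CombData A)} (hR : IsInvariantClass R) (w : List ArrowType)
    {π : CombData A} (hπ : π ∈ R) (lam τ : A → ℝ) :
    ∑ y, lamRun w π lam y * height (runComb w π) (lamRun w π τ) y =
      ∑ y, lam y * height π τ y := by
  induction w generalizing π lam τ with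
  | nil => rfl
  | cons ε w ih =>
    exact (ih (hR.rauzyOp_mem π hπ ε) _ _).trans
      (sum_height_lamStep (hR.irreducible π hπ) ε lam τ)

/-- By irreducibility `y` is not first in both rows, so at least one of the two partial sums is
non-empty and has a strict sign. -/
theorem height_pos {π : CombData A} (hπ : π.Irreducible) {τ : A → ℝ} (h : τ ∈ suspCone π)
    (y : A) : 0 < height π τ y := by
  have hd : 1 < Fintype.card A := Fintype.one_lt_card
  have hty := (π.top y).2
  have hby := (π.bot y).2
  rw [mem_suspCone] at h
  have h1 : 0 < (π.top y : ℕ) → 0 < rowSum π.top τ (π.top y) := fun h0 =>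
    (h _ h0 (by omega)).1
  have h2 : 0 < (π.bot y : ℕ) → rowSum π.bot τ (π.bot y) < 0 := fun h0 =>
    (h _ h0 (by omega)).2
  rw [height]
  rcases Nat.eq_zero_or_pos (π.top y : ℕ) with ht | ht
  · rcases Nat.eq_zero_or_pos (π.bot y : ℕ) with hb | hb
    · refine absurd ?_ (hπ 1 le_rfl hd)
      ext ξ
      simp only [Set.mem_ofPred_eq, Nat.lt_one_iff]
      constructor
      · intro h
        rwa [row_ext π.top (x := ξ) (y := y) (by omega)]
      · intro h
        rwa [row_ext π.bot (x := ξ) (y := y) (by omega)]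
    · rw [ht, rowSum_zero]
      linarith [h2 hb]
  · rcases Nat.eq_zero_or_pos (π.bot y : ℕ) with hb | hb
    · rw [hb, rowSum_zero]
      linarith [h1 ht]
    · linarith [h1 ht, h2 hb]

/-- The vector `ξ ↦ π_b(ξ) - π_t(ξ)` is a suspension datum. -/
theorem suspCone_nonempty {π : CombData A} (hπ : π.Irreducible) : (suspCone π).Nonempty := by
  let τ : A → ℝ := fun ξ => (π.bot ξ : ℝ) - (π.top ξ : ℝ)
  -- The first `k` positions have the least sum among all sets of `k` positions, and strictly so:
  -- each position exchanged is below `k` and is replaced by one at least `k`.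
  have key : ∀ (r s : A ≃ Fin (Fintype.card A)) (k : ℕ),
      {ξ : A | (r ξ : ℕ) < k} ≠ {ξ : A | (s ξ : ℕ) < k} →
      ∑ ξ with (r ξ : ℕ) < k, (r ξ : ℝ) < ∑ ξ with (r ξ : ℕ) < k, (s ξ : ℝ) := by
    intro r s k hne
    classical
    set S : Finset A := {ξ | (r ξ : ℕ) < k} with hS
    set T : Finset A := {ξ | (s ξ : ℕ) < k} with hT
    have hmem : ∀ ξ, (r ξ : ℕ) < k ↔ (s (s.symm (r ξ)) : ℕ) < k := fun ξ => by simp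
    have hsum : ∑ ξ ∈ S, (r ξ : ℝ) = ∑ ξ ∈ T, (s ξ : ℝ) :=
      Finset.sum_equiv (r.trans s.symm) (by simp [hS, hT]) (by simp)
    have hcard : (S \ T).card = (T \ S).card :=
      Finset.card_sdiff_comm (Finset.card_equiv (r.trans s.symm) (by simp [hS, hT]))
    have hpos : 0 < (S \ T).card := by
      rw [Finset.card_pos, Finset.nonempty_iff_ne_empty, Ne, Finset.sdiff_eq_empty_iff_subset]
      intro hsub
      have h' : T ⊆ S := by
        rw [← Finset.sdiff_eq_empty_iff_subset, ← Finset.card_eq_zero, ← hcard,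
          Finset.card_eq_zero, Finset.sdiff_eq_empty_iff_subset]
        exact hsub
      refine hne (Set.ext fun ξ => ?_)
      have := Finset.ext_iff.mp (hsub.antisymm h') ξ
      simpa [hS, hT] using this
    have h1 : (S \ T).card • (k : ℝ) ≤ ∑ ξ ∈ S \ T, (s ξ : ℝ) := by
      refine Finset.card_nsmul_le_sum _ _ _ fun ξ hξ => ?_
      simp only [hS, hT, Finset.mem_sdiff, Finset.mem_filter, Finset.mem_univ, true_and,
        not_lt] at hξ
      exact_mod_cast hξ.2
    have h2 : ∑ ξ ∈ T \ S, (s ξ : ℝ) ≤ (T \ S).card • ((k : ℝ) - 1) := by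
      refine Finset.sum_le_card_nsmul _ _ _ fun ξ hξ => ?_
      simp only [hS, hT, Finset.mem_sdiff, Finset.mem_filter, Finset.mem_univ, true_and,
        not_lt] at hξ
      have : ((s ξ : ℕ) : ℝ) + 1 ≤ k := by exact_mod_cast hξ.1
      linarith
    have h3 := Finset.sum_sdiff_sub_sum_sdiff (s₁ := T) (s₂ := S) (f := fun ξ => (s ξ : ℝ))
    have h4 : (0 : ℝ) < (S \ T).card := by exact_mod_cast hpos
    rw [hsum]
    rw [← hcard] at h2
    simp only [nsmul_eq_mul] at h1 h2
    nlinarith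
  refine ⟨τ, fun k hk hk' => ?_⟩
  have hirr := hπ k hk (by omega)
  have h1 := key π.top π.bot k hirr
  have h2 := key π.bot π.top k hirr.symm
  simp only [τ, Finset.sum_sub_distrib]
  constructor <;> linarith

section

variable {A : Type*} [Fintype A] [DecidableEq A] [Nontrivial A]

/-! ### Orbits of the extended induction -/

/-- The image of a triple under the extended induction steps of the given types. -/
def zippedRun (w : List ArrowType) (x : Zippered A) : Zippered A :=
  ⟨lamRun w x.comb x.lam, runComb w x.comb, lamRun w x.comb x.tau⟩

variable {R : Set (CombData A)}

theorem qHat_eq (hR : IsInvariantClass R) {x : Zippered A} (hx : x.comb ∈ R) {ε : ArrowType}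
    (h : x.lam (loser ε x.comb) < x.lam (winner ε x.comb)) : qHat x = zippedRun [ε] x := by
  obtain ⟨h1, h2⟩ := rauzyQ_of_lt h
  rw [qHat, h2, h1, arrowMatrix_transpose_inv_mulVec (hR.irreducible _ hx)]
  rfl

theorem exists_loser_lt_winner {π : CombData A} {lam : A → ℝ}
    (h : lam π.topLast ≠ lam π.botLast) : ∃ ε, lam (loser ε π) < lam (winner ε π) := by
  rcases lt_or_gt_of_ne h with h | h
  exacts [⟨.bottom, h⟩, ⟨.top, h⟩]

theorem exists_word_of_reflTransGen (hR : IsInvariantClass R) {x y : Zippered A}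
    (h : Relation.ReflTransGen (QHatStep R) x y) (hx : ∀ ξ, 0 < x.lam ξ) :
    ∃ w, x.lam ∈ wordCone w x.comb ∧ y = zippedRun w x := by
  induction h using Relation.ReflTransGen.head_induction_on with
  | refl => exact ⟨[], hx, rfl⟩
  | @head x z hxz _ ih =>
    obtain ⟨⟨hxs, hne⟩, rfl⟩ := hxz
    obtain ⟨ε, hε⟩ := exists_loser_lt_winner hne
    rw [qHat_eq hR hxs.1 hε] at ih
    obtain ⟨w, h1, h2⟩ := ih (lamStep_pos hx hε)
    exact ⟨ε :: w, ⟨hx, hε, h1⟩, h2⟩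

theorem zippedRun_mem (hR : IsInvariantClass R) {x : Zippered A} (hx : x ∈ zipperedSpace R)
    {w : List ArrowType} (h : x.lam ∈ wordCone w x.comb) : zippedRun w x ∈ zipperedSpace R :=
  ⟨hR.runComb_mem w hx.1, lamRun_pos h, lamRun_mem_suspCone hR w hx.1 hx.2.2⟩

theorem reflTransGen_zippedRun (hR : IsInvariantClass R) {x : Zippered A}
    (hx : x ∈ zipperedSpace R) {w : List ArrowType} (h : x.lam ∈ wordCone w x.comb) :
    Relation.ReflTransGen (QHatStep R) x (zippedRun w x) := by
  induction w generalizing x with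
  | nil => exact .refl
  | cons ε w ih =>
    have hstep : QHatStep R x (zippedRun [ε] x) := by
      refine ⟨⟨hx, ?_⟩, qHat_eq hR hx.1 h.2.1⟩
      have := h.2.1
      cases ε
      exacts [this.ne', this.ne]
    have hx' : zippedRun [ε] x ∈ zipperedSpace R :=
      zippedRun_mem hR hx ⟨h.1, h.2.1, pos_of_mem_wordCone h.2.2⟩
    exact .head hstep (ih hx' h.2.2)

theorem scaleFlow_mem {x : Zippered A} (hx : x ∈ zipperedSpace R) (t : ℝ) :
    scaleFlow t x ∈ zipperedSpace R :=
  ⟨hx.1, fun ξ => mul_pos (Real.exp_pos t) (hx.2.1 ξ),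
    smul_mem_suspCone (Real.exp_pos _) hx.2.2⟩

omit [Nontrivial A] [DecidableEq A] in
theorem phi_scaleFlow (t : ℝ) (x : Zippered A) : phi (scaleFlow t x) = Real.exp t * phi x := by
  simp [phi, scaleFlow, Finset.mul_sum]

omit [Nontrivial A] [DecidableEq A] in
theorem area_scaleFlow (t : ℝ) (x : Zippered A) : area (scaleFlow t x) = area x := by
  rw [area, area]
  simp only [scaleFlow, mulVec_smul, dotProduct_smul, smul_dotProduct, smul_eq_mul,
    ← mul_assoc, ← Real.exp_add]
  simp

theorem area_zippedRun (hR : IsInvariantClass R) {x : Zippered A} (hx : x.comb ∈ R)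
    (w : List ArrowType) : area (zippedRun w x) = area x := by
  rw [area_eq, area_eq]
  exact sum_height_lamRun hR w hx x.lam x.tau

/-- Every induction step shortens the length vector, so a point of length `1` lies in the
fundamental domain automatically. -/
theorem mem_transversal (hR : IsInvariantClass R) {x : Zippered A} :
    x ∈ transversal R ↔ x ∈ zipperedSpace R ∧ area x = 1 ∧ phi x = 1 := by
  refine ⟨fun h => ⟨h.1.1, h.2⟩, fun ⟨h1, h2, h3⟩ => ⟨⟨h1, ?_⟩, h2, h3⟩⟩
  by_cases hx : x ∈ qHatDomain R
  · refine .inl ⟨hx, ?_, h3.ge⟩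
    obtain ⟨ε, hε⟩ := exists_loser_lt_winner hx.2
    rw [qHat_eq hR h1.1 hε, ← h3]
    exact sum_lamRun_lt (w := [ε]) ⟨h1.2.1, hε, lamStep_pos h1.2.1 hε⟩ (by simp)
  · exact .inr (.inl ⟨hx, h3.ge⟩)

variable {π : Vertex R} {γ : Quiver.Path π π}

theorem mem_sectionHat (hR : IsInvariantClass R) {x : Zippered A} :
    x ∈ sectionHat γ ↔ x.comb = π.val ∧ x.lam ∈ wordCone (pathTypes γ) π.val ∧ ∑ ξ, x.lam ξ = 1 ∧
      x.tau ∈ suspCone π.val ∧ x.tau ∈ pathSuspCone γ ∧ area x = 1 := by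
  rw [sectionHat, Set.mem_ofPred_eq, mem_transversal hR, mem_pathCone]
  constructor
  · rintro ⟨⟨h1, h2, h3⟩, ⟨h4, h5⟩, h6⟩
    exact ⟨h4, h5, h3, h4 ▸ h1.2.2, h6, h2⟩
  · rintro ⟨h1, h2, h3, h4, h5, h6⟩
    exact ⟨⟨⟨h1 ▸ π.mem, pos_of_mem_wordCone h2, h1.symm ▸ h4⟩, h6, h3⟩, ⟨h1, h2⟩, h5⟩

theorem mem_baseSection {lam : A → ℝ} :
    lam ∈ baseSection γ ↔ lam ∈ wordCone (pathTypes γ) π.val ∧ ∑ ξ, lam ξ = 1 := by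
  rw [baseSection, Set.mem_ofPred_eq, mem_pathCone]
  simp

/-- Every point of the base is the projection of a point of the section. -/
theorem exists_mem_sectionHat (hR : IsInvariantClass R) {lam : A → ℝ}
    (hlam : lam ∈ baseSection γ) : ∃ τ, (⟨lam, π.val, τ⟩ : Zippered A) ∈ sectionHat γ := by
  rw [mem_baseSection] at hlam
  obtain ⟨σ, hσ⟩ := suspCone_nonempty (hR.irreducible _ π.mem)
  set τ := lamRun (pathTypes γ) π.val σ
  have hτ : τ ∈ suspCone π.val := by
    have := lamRun_mem_suspCone hR (pathTypes γ) π.mem hσ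
    rwa [runComb_pathTypes] at this
  have harea : 0 < area (⟨lam, π.val, τ⟩ : Zippered A) := by
    rw [area_eq]
    exact Finset.sum_pos (fun y _ => mul_pos (pos_of_mem_wordCone hlam.1 y)
      (height_pos (hR.irreducible _ π.mem) hτ y)) Finset.univ_nonempty
  have hc := inv_pos.mpr harea
  refine ⟨(area (⟨lam, π.val, τ⟩ : Zippered A))⁻¹ • τ, (mem_sectionHat hR).mpr
    ⟨rfl, hlam.1, hlam.2, smul_mem_suspCone hc hτ, ?_, ?_⟩⟩
  · exact (mem_pathSuspCone hR γ _).mpr ⟨_, smul_mem_suspCone hc hσ, lamRun_smul _ _ _ _⟩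
  · have : area (⟨lam, π.val, (area (⟨lam, π.val, τ⟩ : Zippered A))⁻¹ • τ⟩ : Zippered A) =
        (area (⟨lam, π.val, τ⟩ : Zippered A))⁻¹ * area (⟨lam, π.val, τ⟩ : Zippered A) := by
      simp only [area, mulVec_smul, dotProduct_smul, smul_eq_mul, mul_neg]
    rw [this, inv_mul_cancel₀ harea.ne']

/-! ### Return times -/

/-- The induction takes the length vector back to the section along `u` followed by the loop. -/
def ReturnsAlong (γ : Quiver.Path π π) (lam : A → ℝ) (u : List ArrowType) : Prop :=
  runComb u π.val = π.val ∧ lam ∈ wordCone (u ++ pathTypes γ ++ pathTypes γ) π.val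

/-- The length at the return along `u` followed by the loop. -/
def returnLength (γ : Quiver.Path π π) (lam : A → ℝ) (u : List ArrowType) : ℝ :=
  ∑ ξ, lamRun (u ++ pathTypes γ) π.val lam ξ

/-- The right-hand side does not mention `τ`. The condition on lengths at the return says that `γ`
follows, and the condition on `τ` says that `γ` has just been followed; neatness keeps the
occurrences of `γ` from overlapping. -/
theorem mem_returnTimes (hR : IsInvariantClass R) (hγ : Neat γ) {lam τ : A → ℝ}
    (hx : (⟨lam, π.val, τ⟩ : Zippered A) ∈ sectionHat γ) (t : ℝ) :
    t ∈ returnTimes γ ⟨lam, π.val, τ⟩ ↔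
      ∃ u, ReturnsAlong γ lam u ∧ Real.exp (-t) = returnLength γ lam u := by
  obtain ⟨-, hlam, hsum, hτ, hτγ, harea⟩ := (mem_sectionHat hR).mp hx
  simp only at hlam hsum hτ hτγ
  have hxs : (⟨lam, π.val, τ⟩ : Zippered A) ∈ zipperedSpace R :=
    ⟨π.mem, pos_of_mem_wordCone hlam, hτ⟩
  have hloop := runComb_pathTypes γ
  have hphi : phi (scaleFlow t (⟨lam, π.val, τ⟩ : Zippered A)) = Real.exp t := by
    rw [phi_scaleFlow, phi, hsum, mul_one]
  set g := pathTypes γ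
  constructor
  · rintro ⟨ht, y, hy, -, horb | horb⟩
    · obtain ⟨w, hw, rfl⟩ := exists_word_of_reflTransGen hR horb (scaleFlow_mem hxs t).2.1
      obtain ⟨h1, h2, h3, -, h5, -⟩ := (mem_sectionHat hR).mp hy
      simp only [zippedRun, scaleFlow] at h1 h2 h3 h5 hw
      have hw' : lam ∈ wordCone w π.val := by
        have := smul_mem_wordCone (Real.exp_pos (-t)) hw
        rwa [smul_smul, ← Real.exp_add, neg_add_cancel, Real.exp_zero, one_smul] at this
      rw [lamRun_smul] at h2 h3
      have h2' : lamRun w π.val lam ∈ wordCone g π.val := by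
        have := smul_mem_wordCone (Real.exp_pos (-t)) h2
        rwa [smul_smul, ← Real.exp_add, neg_add_cancel, Real.exp_zero, one_smul] at this
      have hwne : w ≠ [] := by
        rintro rfl
        simp only [lamRun, Pi.smul_apply, smul_eq_mul, ← Finset.mul_sum, hsum, mul_one] at h3
        exact (Real.one_lt_exp_iff.mpr ht).ne' h3
      have hwg : lam ∈ wordCone (w ++ g) π.val :=
        mem_wordCone_append.mpr ⟨hw', by rwa [h1]⟩
      have hpre : g <+: w ++ g := prefix_of_mem_wordCone hlam hwg (by simp)
      have hlen : g.length ≤ w.length := by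
        -- If `w` were shorter than the loop, the overlap `d` of the two occurrences would be both
        -- an initial and a final segment of it, neither trivial nor the whole loop.
        by_contra! hlt
        obtain ⟨d, hd⟩ := List.prefix_of_prefix_length_le (List.prefix_append w g) hpre hlt.le
        obtain ⟨e, he⟩ : d <+: g := by
          rw [← hd] at hpre
          nth_rewrite 2 [hd] at hpre
          exact (List.prefix_append_right_inj w).mp hpre
        have hlen' := congrArg List.length hd
        rw [List.length_append] at hlen'
        rcases hγ.eq_or_eq_nil hR hd.symm he.symm h1 with h | h
        · have h' : d.length = g.length := by rw [h]
          exact hwne (List.length_eq_zero_iff.mp (by omega))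
        · simp [h] at hlen'
          omega
      obtain ⟨σ', hσ', e1⟩ := (mem_pathSuspCone hR γ _).mp h5
      obtain ⟨σ, hσ, e2⟩ := (mem_pathSuspCone hR γ _).mp hτγ
      -- The vector at the return is reached from suspension data both along `g ++ w` and along `g`,
      -- so the last arrows agree.
      have hsuf : g <:+ g ++ w := by
        refine suffix_of_lamRun_eq hR π.mem π.mem
          (smul_mem_suspCone (Real.exp_pos (-t)) hσ) hσ' ?_ ?_ (by simp)
        · rw [runComb_append, hloop, h1]
        · rw [e1, lamRun_append, hloop, lamRun_smul, e2]
      obtain ⟨u, rfl⟩ := List.suffix_of_suffix_length_le hsuf (List.suffix_append g w) hlen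
      refine ⟨u, ⟨runComb_injective g ?_, hwg⟩, ?_⟩
      · rw [hloop, ← runComb_append, h1]
      · simp only [Pi.smul_apply, smul_eq_mul, ← Finset.mul_sum] at h3
        rw [Real.exp_neg, returnLength]
        exact inv_eq_of_mul_eq_one_right h3
    -- Backward orbits do not come back: the point of length `e ^ t > 1` would be an induction image
    -- of one of length `1`.
    · exfalso
      have hy' := (mem_sectionHat hR).mp hy
      obtain ⟨w, hw, h2⟩ := exists_word_of_reflTransGen hR horb (pos_of_mem_wordCone hy'.2.1)
      have h3 : phi (zippedRun w y) ≤ 1 := (sum_lamRun_le hw).trans hy'.2.2.1.le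
      rw [← h2, hphi] at h3
      exact (Real.one_lt_exp_iff.mpr ht).not_ge h3
  · rintro ⟨u, ⟨hu, hcone⟩, hexp⟩
    obtain ⟨hcone1, hcone2⟩ := mem_wordCone_append.mp hcone
    have hcomb : runComb (u ++ g) π.val = π.val := by rw [runComb_append, hu, hloop]
    rw [hcomb] at hcone2
    have ht : 0 < t := by
      have hne : u ++ g ≠ [] := by simp [g, hγ.1.pathTypes_ne_nil]
      have : Real.exp (-t) < 1 := by
        rw [hexp, ← hsum]
        exact sum_lamRun_lt hcone1 hne
      rw [Real.exp_lt_one_iff] at this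
      linarith
    have hconet : (scaleFlow t (⟨lam, π.val, τ⟩ : Zippered A)).lam ∈ wordCone (u ++ g) π.val :=
      smul_mem_wordCone (Real.exp_pos t) hcone1
    have hys := zippedRun_mem hR (scaleFlow_mem hxs t) hconet
    have hmem : zippedRun (u ++ g) (scaleFlow t ⟨lam, π.val, τ⟩) ∈ sectionHat γ := by
      refine (mem_sectionHat hR).mpr ⟨hcomb, ?_, ?_, ?_, ?_, ?_⟩
      · simp only [zippedRun, scaleFlow, lamRun_smul]
        exact smul_mem_wordCone (Real.exp_pos t) hcone2
      · simp only [zippedRun, scaleFlow, lamRun_smul, Pi.smul_apply, smul_eq_mul,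
          ← Finset.mul_sum]
        change Real.exp t * returnLength γ lam u = 1
        rw [← hexp, ← Real.exp_add, add_neg_cancel,
          Real.exp_zero]
      · have := hys.2.2
        rwa [show (zippedRun (u ++ g) (scaleFlow t ⟨lam, π.val, τ⟩)).comb = π.val from hcomb]
          at this
      · refine (mem_pathSuspCone hR γ _).mpr ⟨lamRun u π.val (Real.exp (-t) • τ), ?_, ?_⟩
        · have := lamRun_mem_suspCone hR u π.mem (smul_mem_suspCone (Real.exp_pos (-t)) hτ)
          rwa [hu] at this
        · simp only [zippedRun, scaleFlow, lamRun_append, hu, g]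
      · rw [area_zippedRun hR (x := scaleFlow t ⟨lam, π.val, τ⟩) π.mem, area_scaleFlow, harea]
    exact ⟨ht, _, hmem, hmem.1.1, .inl (reflTransGen_zippedRun hR (scaleFlow_mem hxs t) hconet)⟩

theorem returnLength_pos {lam : A → ℝ} {u : List ArrowType} (h : ReturnsAlong γ lam u) :
    0 < returnLength γ lam u :=
  Finset.sum_pos (fun ξ _ => lamRun_pos (mem_wordCone_append.mp h.2).1 ξ) Finset.univ_nonempty

theorem returnLength_le_of_length_le {lam : A → ℝ} {u v : List ArrowType}
    (hu : ReturnsAlong γ lam u) (hv : ReturnsAlong γ lam v) (h : u.length ≤ v.length) :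
    returnLength γ lam v ≤ returnLength γ lam u := by
  have hu' := (mem_wordCone_append.mp hu.2).1
  have hv' := (mem_wordCone_append.mp hv.2).1
  obtain ⟨d, hd⟩ := prefix_of_mem_wordCone hu' hv' (by simpa using h)
  rw [returnLength, ← hd, lamRun_append]
  rw [← hd] at hv'
  exact sum_lamRun_le (mem_wordCone_append.mp hv').2

/-- The roof function is the first return time, for every point over a length vector that
returns. -/
theorem isLeast_roof (hR : IsInvariantClass R) (hγ : Neat γ) {lam : A → ℝ}
    (hlam : lam ∈ baseSection γ) (hret : ∃ u, ReturnsAlong γ lam u) :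
    IsLeast {t | ∃ u, ReturnsAlong γ lam u ∧ Real.exp (-t) = returnLength γ lam u}
      (roof γ lam) := by
  classical
  have hex : ∃ n, ∃ u, ReturnsAlong γ lam u ∧ u.length = n := by
    obtain ⟨u, hu⟩ := hret
    exact ⟨_, u, hu, rfl⟩
  obtain ⟨u, hu, hun⟩ := Nat.find_spec hex
  have hpos := returnLength_pos hu
  have hleast : IsLeast {t | ∃ u, ReturnsAlong γ lam u ∧ Real.exp (-t) = returnLength γ lam u}
      (-Real.log (returnLength γ lam u)) := by
    refine ⟨⟨u, hu, by rw [neg_neg, Real.exp_log hpos]⟩, ?_⟩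
    rintro t ⟨v, hv, ht⟩
    -- Lengths decrease along the induction, so the shortest word gives the longest vector and the
    -- least time.
    have h1 : u.length ≤ v.length := hun.trans_le (Nat.find_min' hex ⟨v, hv, rfl⟩)
    have h2 := returnLength_le_of_length_le hu hv h1
    rw [← ht, ← Real.le_log_iff_exp_le hpos] at h2
    linarith
  have hset : {t | ∃ τ : A → ℝ, (⟨lam, π.val, τ⟩ : Zippered A) ∈ sectionHat γ ∧
      t ∈ returnTimes γ ⟨lam, π.val, τ⟩} =
      {t | ∃ u, ReturnsAlong γ lam u ∧ Real.exp (-t) = returnLength γ lam u} := by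
    ext t
    constructor
    · rintro ⟨τ, hτ, ht⟩
      exact (mem_returnTimes hR hγ hτ t).mp ht
    · intro ht
      obtain ⟨τ, hτ⟩ := exists_mem_sectionHat hR hlam
      exact ⟨τ, hτ, (mem_returnTimes hR hγ hτ t).mpr ht⟩
  rw [roof, hset, hleast.csInf_eq]
  exact hleast

end

section

variable {A : Type*} [Fintype A] [DecidableEq A] [Nontrivial A]

/-! ### Exponential tails -/

variable {R : Set (CombData A)} {π : Vertex R} {γ : Quiver.Path π π}

theorem measurableSet_baseSection : MeasurableSet (baseSection γ) := by
  have : baseSection γ = wordCone (pathTypes γ) π.val ∩ {lam | ∑ ξ, lam ξ = 1} := by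
    ext lam
    exact mem_baseSection
  rw [this]
  exact (measurableSet_wordCone _ _).inter (measurableSet_eq_fun (by fun_prop) measurable_const)

theorem roof_pos (hR : IsInvariantClass R) (hγ : Neat γ) {lam : A → ℝ}
    (hlam : lam ∈ baseSection γ) (hret : ∃ u, ReturnsAlong γ lam u) : 0 < roof γ lam := by
  obtain ⟨τ, hτ⟩ := exists_mem_sectionHat hR hlam
  exact ((mem_returnTimes hR hγ hτ _).mpr (isLeast_roof hR hγ hlam hret).1).1

open Classical in
/-- The length at the first return. -/
def firstReturnLength (γ : Quiver.Path π π) (lam : A → ℝ) : ℝ :=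
  ⨆ u, if ReturnsAlong γ lam u then returnLength γ lam u else 0

theorem measurable_firstReturnLength (γ : Quiver.Path π π) :
    Measurable (firstReturnLength γ) := by
  classical
  refine Measurable.iSup fun u => Measurable.ite ?_ ?_ measurable_const
  · exact (MeasurableSet.const _).inter (measurableSet_wordCone _ _)
  · exact Finset.measurable_sum _ fun ξ _ =>
      (measurable_pi_apply ξ).comp (measurable_lamRun _ _)

/-- This makes the roof measurable up to a null set: it expresses the roof by a countable supremum
of measurable functions. The value `0` for words that give no return lies below every return length.
-/
theorem firstReturnLength_eq (hR : IsInvariantClass R) (hγ : Neat γ) {lam : A → ℝ}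
    (hlam : lam ∈ baseSection γ) (hret : ∃ u, ReturnsAlong γ lam u) :
    firstReturnLength γ lam = Real.exp (-roof γ lam) := by
  classical
  obtain ⟨⟨u, hu, he⟩, hle⟩ := isLeast_roof hR hγ hlam hret
  have hbound : ∀ v, (if ReturnsAlong γ lam v then returnLength γ lam v else 0) ≤
      Real.exp (-roof γ lam) := by
    intro v
    split_ifs with hv
    · have hpos := returnLength_pos hv
      have := hle ⟨v, hv, by rw [neg_neg, Real.exp_log hpos]⟩
      rw [← Real.log_le_iff_le_exp hpos]
      linarith
    · exact (Real.exp_pos _).le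
  refine le_antisymm (ciSup_le hbound) ?_
  rw [he]
  refine le_trans (le_of_eq ?_) (le_ciSup ⟨_, Set.forall_mem_range.mpr hbound⟩ u)
  rw [if_pos hu]

/-- The cone of the length vectors that do not meet the section twice in a row before the weights
have grown by the factor `L`. -/
def lateCone (γ : Quiver.Path π π) (L : ℝ) : Set (A → ℝ) :=
  {lam | (∀ ξ, 0 < lam ξ) ∧
    ¬ Hits (Reach.wordGoal π.val (pathTypes γ ++ pathTypes γ) L) ⟨π.val, 1, []⟩ lam}

theorem mem_lateCone {L : ℝ} {lam : A → ℝ} : lam ∈ lateCone γ L ↔ (∀ ξ, 0 < lam ξ) ∧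
    ∀ w, WalkState.run w ⟨π.val, 1, []⟩ ∈ Reach.wordGoal π.val (pathTypes γ ++ pathTypes γ) L →
      lam ∉ wordCone w π.val := by
  refine and_congr_right fun h => ?_
  rw [hits_iff h]
  push Not
  exact forall_congr' fun w => ⟨fun h1 h2 h3 => h1 h3 h2, fun h1 h2 h3 => h1 h3 h2⟩

theorem measurableSet_lateCone (γ : Quiver.Path π π) (L : ℝ) : MeasurableSet (lateCone γ L) := by
  have : lateCone γ L = {lam | ∀ ξ, 0 < lam ξ} ∩ ⋂ w, ⋂ (_ : WalkState.run w ⟨π.val, 1, []⟩ ∈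
      Reach.wordGoal π.val (pathTypes γ ++ pathTypes γ) L), (wordCone w π.val)ᶜ := by
    ext lam
    rw [mem_lateCone]
    simp
  rw [this]
  exact measurableSet_pos.inter (MeasurableSet.iInter fun w => MeasurableSet.iInter fun _ =>
    (measurableSet_wordCone _ _).compl)

theorem smul_mem_lateCone {L : ℝ} {lam : A → ℝ} (h : lam ∈ lateCone γ L) {t : ℝ} (ht : 0 < t) :
    t • lam ∈ lateCone γ L := by
  rw [mem_lateCone] at *
  refine ⟨fun ξ => mul_pos ht (h.1 ξ), fun w hw hmem => h.2 w hw ?_⟩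
  have := smul_mem_wordCone (inv_pos.mpr ht) hmem
  rwa [smul_smul, inv_mul_cancel₀ ht.ne', one_smul] at this

theorem start_mem_goodStates (π : Vertex R) :
    (⟨π.val, 1, []⟩ : WalkState A) ∈ goodStates R := ⟨π.mem, fun _ => one_pos⟩

/-- A length vector outside the late cone returns, after a bounded time. -/
theorem exists_returnsAlong (hR : IsInvariantClass R) {L : ℝ} {lam : A → ℝ}
    (hlam : ∀ ξ, 0 < lam ξ) (h : lam ∉ lateCone γ L) :
    ∃ u, ReturnsAlong γ lam u ∧ ∑ ξ, lam ξ ≤ L * returnLength γ lam u := by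
  rw [mem_lateCone] at h
  push Not at h
  obtain ⟨w, ⟨h1, ⟨v, h2⟩, h3⟩, h4⟩ := h hlam
  have hloop := runComb_pathTypes γ
  rw [WalkState.run_hist, List.append_nil] at h2
  obtain rfl : w = v.reverse ++ pathTypes γ ++ pathTypes γ := by
    rw [← List.reverse_reverse w, h2]
    simp
  rw [WalkState.run_comb] at h1
  refine ⟨v.reverse, ⟨?_, h4⟩, ?_⟩
  · refine runComb_injective (pathTypes γ ++ pathTypes γ) ?_
    rw [← runComb_append, ← List.append_assoc, h1, runComb_append, hloop, hloop]
  · obtain ⟨h5, h6⟩ := mem_wordCone_append.mp h4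
    have hL : 0 ≤ L := by
      obtain ⟨ξ⟩ : Nonempty A := inferInstance
      exact ((WalkState.run_mem_goodStates hR _ (start_mem_goodStates π)).2 ξ).le.trans (h3 ξ)
    have h7 := sum_wt_mul_lamRun hR (v.reverse ++ pathTypes γ ++ pathTypes γ)
      (start_mem_goodStates π) lam
    simp only [Pi.one_apply, one_mul] at h7
    -- The initial weights are all `1`, so the invariant pairing equals the initial length. The
    -- second copy of the loop only shortens the vector, so it can be dropped from the bound.
    rw [← h7]
    calc _ ≤ ∑ ξ, L * lamRun (v.reverse ++ pathTypes γ ++ pathTypes γ) π.val lam ξ :=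
          Finset.sum_le_sum fun ξ _ => mul_le_mul_of_nonneg_right (h3 ξ) (lamRun_pos h4 ξ).le
      _ = L * ∑ ξ, lamRun (v.reverse ++ pathTypes γ ++ pathTypes γ) π.val lam ξ :=
          (Finset.mul_sum ..).symm
      _ ≤ _ := by
          refine mul_le_mul_of_nonneg_left ?_ hL
          rw [lamRun_append]
          exact sum_lamRun_le h6

theorem everyLetterWins (hR : IsRauzyClass R) (hγ : Neat γ) : EveryLetterWins R := by
  intro ρ hρ ξ
  obtain ⟨u, hu⟩ := hR.exists_runComb_eq hρ π.mem
  obtain ⟨w, ε, hw⟩ := hγ.1.exists_winner ξ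
  exact ⟨u ++ w, ε, by rwa [runComb_append, hu]⟩

/-- The measure of the late cones decreases exponentially. -/
theorem exists_hyperplaneLebesgue_lateCone_le (hR : IsRauzyClass R) (hγ : Neat γ) :
    ∃ (C : ENNReal) (θ K : ℝ), C < ⊤ ∧ 0 < θ ∧ θ < 1 ∧ 1 < K ∧ ∀ k : ℕ,
      hyperplaneLebesgue A (lateCone γ (K ^ k)) ≤ C * ENNReal.ofReal (θ ^ k) := by
  have hloop := runComb_pathTypes γ
  obtain ⟨ρ, K, hρ, hρ1, hK, h⟩ := Reach.word_iterate hR.isInvariantClass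
    (everyLetterWins hR hγ) (π := π.val) (v := pathTypes γ ++ pathTypes γ) (fun ρ hρ => by
      obtain ⟨u, hu⟩ := hR.exists_runComb_eq hρ π.mem
      exact ⟨u, by rw [runComb_append, hu, runComb_append, hloop, hloop]⟩)
  obtain ⟨C, hC, hcone⟩ := exists_hyperplaneLebesgue_le A
  set V := volume (weightSimplex (1 : A → ℝ))
  have hV : V < ⊤ := volume_weightSimplex_one_lt_top
  refine ⟨C * V, 1 - ρ, K, ENNReal.mul_lt_top hC hV, by linarith, by linarith, hK, fun k => ?_⟩
  have hθ : 0 ≤ (1 - ρ) ^ k := pow_nonneg (by linarith) k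
  have hθ1 : (1 - ρ) ^ k ≤ 1 := pow_le_one₀ (by linarith) (by linarith)
  have h1 := (h k 1 one_pos _ (start_mem_goodStates π) fun _ => le_rfl).volume_le
    hR.isInvariantClass (start_mem_goodStates π)
  rw [mul_one] at h1
  refine (hcone _ (measurableSet_lateCone γ _) (fun x hx => hx.1)
    fun x hx t ht => smul_mem_lateCone hx ht).trans ?_
  rw [mul_assoc]
  gcongr
  have hsub : lateCone γ (K ^ k) ∩ {x | ∑ ξ, x ξ < 1} ⊆
      weightSimplex (1 : A → ℝ) ∩ lateCone γ (K ^ k) := by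
    rintro x ⟨hx, hx1⟩
    exact ⟨⟨hx.1, by simpa using hx1⟩, hx⟩
  refine (measure_mono hsub).trans ?_
  set H := {x | Hits (Reach.wordGoal π.val (pathTypes γ ++ pathTypes γ) (K ^ k))
    (⟨π.val, 1, []⟩ : WalkState A) x} with hH
  -- In the simplex the late cone is the complement of the hitting set, whose share is at least `1 -
  -- (1 - ρ) ^ k`.
  have h2 : volume (weightSimplex (1 : A → ℝ) ∩ H) +
      volume (weightSimplex (1 : A → ℝ) ∩ lateCone γ (K ^ k)) = V := by
    refine (add_comm _ _).trans (Eq.trans ?_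
      (measure_inter_add_sdiff (weightSimplex 1) (measurableSet_lateCone γ (K ^ k))))
    congr 2
    ext x
    simp only [Set.mem_inter_iff, Set.mem_sdiff, and_congr_right_iff, lateCone, hH,
      Set.mem_ofPred_eq, not_and, not_not]
    exact fun hx => ⟨fun h _ => h, fun h => h hx.1⟩
  have h3 : ENNReal.ofReal (1 - (1 - ρ) ^ k) * V + V * ENNReal.ofReal ((1 - ρ) ^ k) = V := by
    rw [mul_comm V, ← add_mul, ← ENNReal.ofReal_add (by linarith) hθ]
    simp
  have h4 : ENNReal.ofReal (1 - (1 - ρ) ^ k) * V ≠ ⊤ :=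
    (ENNReal.mul_lt_top ENNReal.ofReal_lt_top hV).ne
  refine (ENNReal.add_le_add_iff_left h4).mp ?_
  rw [h3]
  exact (add_le_add h1 le_rfl).trans h2.le

theorem roof_le (hR : IsInvariantClass R) (hγ : Neat γ) {L : ℝ} {lam : A → ℝ}
    (hlam : lam ∈ baseSection γ) (h : lam ∉ lateCone γ L) : roof γ lam ≤ Real.log L := by
  obtain ⟨h1, h2⟩ := mem_baseSection.mp hlam
  obtain ⟨u, hu, hL⟩ := exists_returnsAlong hR (pos_of_mem_wordCone h1) h
  have hpos := returnLength_pos hu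
  rw [h2] at hL
  have h3 := (isLeast_roof hR hγ hlam ⟨u, hu⟩).2 ⟨u, hu, by rw [neg_neg, Real.exp_log hpos]⟩
  refine h3.trans ?_
  rw [← Real.log_inv]
  exact Real.log_le_log (inv_pos.mpr hpos) ((inv_le_iff_one_le_mul₀ hpos).mpr hL)

theorem ae_exists_notMem_lateCone {C : ENNReal} {θ K : ℝ} (hC : C < ⊤) (hθ : 0 < θ) (hθ1 : θ < 1)
    (h : ∀ k : ℕ, hyperplaneLebesgue A (lateCone γ (K ^ k)) ≤ C * ENNReal.ofReal (θ ^ k)) :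
    ∀ᵐ lam ∂(hyperplaneLebesgue A), ∃ k : ℕ, lam ∉ lateCone γ (K ^ k) := by
  rw [ae_iff]
  have hlim : Filter.Tendsto (fun k : ℕ => C * ENNReal.ofReal (θ ^ k)) Filter.atTop (nhds 0) := by
    have h1 := ENNReal.tendsto_ofReal (tendsto_pow_atTop_nhds_zero_of_lt_one hθ.le hθ1)
    rw [ENNReal.ofReal_zero] at h1
    simpa using ENNReal.Tendsto.const_mul (a := C) h1 (.inr hC.ne)
  refine le_antisymm (ge_of_tendsto' hlim fun k => (measure_mono ?_).trans (h k)) zero_le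
  intro lam hlam
  by_contra hk
  exact hlam ⟨k, hk⟩

theorem aestronglyMeasurable_exp_roof (hR : IsInvariantClass R) (hγ : Neat γ)
    (h : ∀ᵐ lam ∂((hyperplaneLebesgue A).restrict (baseSection γ)),
      lam ∈ baseSection γ ∧ ∃ u, ReturnsAlong γ lam u) (σ : ℝ) :
    AEStronglyMeasurable (fun lam => Real.exp (σ * roof γ lam))
      ((hyperplaneLebesgue A).restrict (baseSection γ)) := by
  refine ⟨fun lam => Real.exp (σ * -Real.log (firstReturnLength γ lam)), ?_, ?_⟩
  · have := measurable_firstReturnLength γ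
    exact (by fun_prop : Measurable fun lam =>
      Real.exp (σ * -Real.log (firstReturnLength γ lam))).stronglyMeasurable
  · filter_upwards [h] with lam hlam
    rw [firstReturnLength_eq hR hγ hlam.1 hlam.2, Real.log_exp, neg_neg]

theorem exp_roof_le_tsum (hR : IsInvariantClass R) (hγ : Neat γ) {K σ : ℝ} (hσ : 0 < σ)
    {lam : A → ℝ} (hlam : lam ∈ baseSection γ) (h : ∃ k : ℕ, lam ∉ lateCone γ (K ^ k)) :
    ENNReal.ofReal (Real.exp (σ * roof γ lam)) ≤ ∑' k : ℕ, (lateCone γ (K ^ k)).indicator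
      (fun _ => ENNReal.ofReal (Real.exp (σ * ((k + 1) * Real.log K)))) lam := by
  classical
  obtain ⟨h1, -⟩ := mem_baseSection.mp hlam
  have hspec := Nat.find_spec h
  have hret : ∃ u, ReturnsAlong γ lam u := by
    obtain ⟨u, hu, -⟩ := exists_returnsAlong hR (pos_of_mem_wordCone h1) hspec
    exact ⟨u, hu⟩
  have hle := roof_le hR hγ hlam hspec
  have hpos := roof_pos hR hγ hlam hret
  -- Index `0` would give a roof of at most `log 1 = 0`, but return times are positive.
  obtain ⟨k, hk⟩ : ∃ k, Nat.find h = k + 1 := by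
    refine Nat.exists_eq_succ_of_ne_zero fun h0 => ?_
    rw [h0, pow_zero, Real.log_one] at hle
    linarith
  have hmem : lam ∈ lateCone γ (K ^ k) := by
    by_contra hnot
    have := Nat.find_min' h hnot
    omega
  refine le_trans ?_ (ENNReal.le_tsum k)
  rw [Set.indicator_of_mem hmem]
  refine ENNReal.ofReal_le_ofReal (Real.exp_le_exp.mpr (mul_le_mul_of_nonneg_left ?_ hσ.le))
  rw [hk, Real.log_pow] at hle
  exact_mod_cast hle

theorem hasExponentialTails_roof (hR : IsRauzyClass R) (hγ : Neat γ) :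
    HasExponentialTails ((hyperplaneLebesgue A).restrict (baseSection γ)) (roof γ) ∧
      ∀ᵐ lam ∂((hyperplaneLebesgue A).restrict (baseSection γ)),
        lam ∈ baseSection γ ∧ ∃ u, ReturnsAlong γ lam u := by
  have hR' := hR.isInvariantClass
  obtain ⟨C, θ, K, hC, hθ, hθ1, hK, htail⟩ := exists_hyperplaneLebesgue_lateCone_le hR hγ
  have hnot : ∀ᵐ lam ∂((hyperplaneLebesgue A).restrict (baseSection γ)),
      lam ∈ baseSection γ ∧ ∃ k : ℕ, lam ∉ lateCone γ (K ^ k) := by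
    filter_upwards [ae_restrict_mem measurableSet_baseSection,
      ae_restrict_of_ae (ae_exists_notMem_lateCone hC hθ hθ1 htail)] with lam h1 h2
    exact ⟨h1, h2⟩
  have hret : ∀ᵐ lam ∂((hyperplaneLebesgue A).restrict (baseSection γ)),
      lam ∈ baseSection γ ∧ ∃ u, ReturnsAlong γ lam u := by
    filter_upwards [hnot] with lam ⟨h1, k, h2⟩
    obtain ⟨u, hu, -⟩ := exists_returnsAlong hR' (pos_of_mem_wordCone (mem_baseSection.mp h1).1) h2
    exact ⟨h1, u, hu⟩
  have hc : 0 < Real.log K := Real.log_pos hK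
  have hlogθ : Real.log θ < 0 := Real.log_neg hθ hθ1
  -- This means `K ^ σ = θ ^ (-1/2)`: the exponential growth uses up half of the decay `θ ^ k`, and
  -- a geometric series of ratio `θ ^ (1/2)` remains.
  set σ := -Real.log θ / (2 * Real.log K) with hσdef
  have hσ : 0 < σ := div_pos (by linarith) (by linarith)
  have hσc : σ * Real.log K = -Real.log θ / 2 := by
    rw [hσdef]
    field_simp
  set r := Real.exp (Real.log θ / 2)
  have hr1 : r < 1 := Real.exp_lt_one_iff.mpr (by linarith)
  have hterm : ∀ k : ℕ, Real.exp (σ * ((k + 1) * Real.log K)) * θ ^ k =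
      Real.exp (-Real.log θ / 2) * r ^ k := by
    intro k
    have h1 : θ ^ k = Real.exp (k * Real.log θ) := by rw [Real.exp_nat_mul, Real.exp_log hθ]
    rw [h1, ← Real.exp_nat_mul, ← Real.exp_add, ← Real.exp_add]
    congr 1
    linear_combination (k + 1 : ℝ) * hσc
  refine ⟨⟨σ, hσ, aestronglyMeasurable_exp_roof hR' hγ hret σ, ?_⟩, hret⟩
  rw [hasFiniteIntegral_iff_ofReal (Filter.Eventually.of_forall fun _ => (Real.exp_pos _).le)]
  calc ∫⁻ lam in baseSection γ, ENNReal.ofReal (Real.exp (σ * roof γ lam)) ∂hyperplaneLebesgue A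
      ≤ ∫⁻ lam in baseSection γ, ∑' k : ℕ, (lateCone γ (K ^ k)).indicator
          (fun _ => ENNReal.ofReal (Real.exp (σ * ((k + 1) * Real.log K)))) lam
          ∂hyperplaneLebesgue A := by
        refine lintegral_mono_ae ?_
        filter_upwards [hnot] with lam hlam
        exact exp_roof_le_tsum hR' hγ hσ hlam.1 hlam.2
    _ ≤ ∫⁻ lam, ∑' k : ℕ, (lateCone γ (K ^ k)).indicator
          (fun _ => ENNReal.ofReal (Real.exp (σ * ((k + 1) * Real.log K)))) lam
          ∂hyperplaneLebesgue A := setLIntegral_le_lintegral _ _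
    _ = ∑' k : ℕ, ENNReal.ofReal (Real.exp (σ * ((k + 1) * Real.log K))) *
          hyperplaneLebesgue A (lateCone γ (K ^ k)) := by
        rw [lintegral_tsum fun k => (measurable_const.indicator
          (measurableSet_lateCone γ _)).aemeasurable]
        exact tsum_congr fun k => lintegral_indicator_const (measurableSet_lateCone γ _) _
    _ ≤ ∑' k : ℕ, ENNReal.ofReal (Real.exp (-Real.log θ / 2)) * C * ENNReal.ofReal r ^ k := by
        refine ENNReal.tsum_le_tsum fun k => ?_
        calc _ ≤ ENNReal.ofReal (Real.exp (σ * ((k + 1) * Real.log K))) *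
              (C * ENNReal.ofReal (θ ^ k)) := by gcongr; exact htail k
          _ = C * ENNReal.ofReal (Real.exp (σ * ((k + 1) * Real.log K)) * θ ^ k) := by
              rw [ENNReal.ofReal_mul (Real.exp_pos _).le]
              ring
          _ = _ := by
              rw [hterm, ENNReal.ofReal_mul (Real.exp_pos _).le,
                ENNReal.ofReal_pow (Real.exp_pos _).le]
              ring
    _ < ⊤ := by
        rw [ENNReal.tsum_mul_left, ENNReal.tsum_geometric]
        refine ENNReal.mul_lt_top (ENNReal.mul_lt_top ENNReal.ofReal_lt_top hC) ?_
        rw [ENNReal.inv_lt_top, tsub_pos_iff_lt]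
        exact ENNReal.ofReal_lt_one.mpr hr1

end

end Veech

end

theorem mainTheorem7 {A : Type*} [Fintype A] [DecidableEq A] [Nontrivial A]
    (R : Set (Veech.CombData A)) (hR : Veech.IsRauzyClass R)
    (π : Veech.Vertex R) (γ : Quiver.Path π π) (hγ : Veech.Neat γ) :
    -- almost every point of the base returns, at a first time that depends on `lam` only
    (∀ᵐ lam ∂((Veech.hyperplaneLebesgue A).restrict (Veech.baseSection γ)), ∀ τ : A → ℝ,
      (⟨lam, π.val, τ⟩ : Veech.Zippered A) ∈ Veech.sectionHat γ →
        IsLeast (Veech.returnTimes γ ⟨lam, π.val, τ⟩) (Veech.roof γ lam)) ∧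
    Veech.HasExponentialTails
      ((Veech.hyperplaneLebesgue A).restrict (Veech.baseSection γ)) (Veech.roof γ) := by
  obtain ⟨htails, hret⟩ := Veech.hasExponentialTails_roof hR hγ
  refine ⟨?_, htails⟩
  filter_upwards [hret] with lam ⟨hlam, hu⟩ τ hτ
  have hset : Veech.returnTimes γ ⟨lam, π.val, τ⟩ = _ :=
    Set.ext (Veech.mem_returnTimes hR.isInvariantClass hγ hτ)
  rw [hset]
  exact Veech.isLeast_roof hR.isInvariantClass hγ hlam hu
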